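/- **Setting.** Let $\mu$ be Wiener measure on $\Omega=C([0,1],\mathbb R^m)$ (the law of standard $m$-dimensional Brownian motion), and let $\mathrm H$ be the Cameron–Martin space of paths $\mathrm h$ from the origin with $\|\mathrm h\|_{\mathrm H}=\|\dot{\mathrm h}\|_{L^2([0,1],\mathbb R^m)}<\infty$. Fix $0<\kappa<\tfrac12$, put $\alpha=\tfrac12-\kappa$, and let $C^\alpha$ be the space of $\alpha$-Hölder paths from the origin. *Models.* Symbols are generated by the noises $\Xi_1,\dots,\Xi_m$, by products, and by $\mathcal I_H$ (recentred convolution with $K^H(u,t)=\sqrt{2H}\,|t-u|^{H-1/2}1_{u<t}$, $H\in(0,\tfrac12]$; for $H=\tfrac12$ this is indefinite integration). The homogeneity is $-\tfrac12-\kappa$ for $\Xi_j$, increases by $\tfrac12+H$ under $\mathcal I_H$, and is additive in products; $\deg\tau$ is the number of noises in $\tau$. Let $S$ be a finite set of products of symbols $\mathcal I_H(\cdot)$, all of positive homogeneity, containing $\mathcal I_{1/2}(\Xi_j)$ for all $j$. A model $\mathbf M=(M^\tau_{s,t})_{\tau\in S,\,0\le s<t\le1}$ is a real tuple with $\|M^\tau\|:=\sup_{s<t}|M^\tau_{s,t}|/(t-s)^{|\tau|}<\infty$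 for the homogeneity $|\tau|$, whose components $\mathcal I_{1/2}(\Xi_j)$ are the increments of a path $M=(M^1,\dots,M^m)$ with $M(0)=0$. Models carry the metric $\sum_\tau\|M^\tau-N^\tau\|$, the homogeneous norm $|||\mathbf M|||=\sum_\tau\|M^\tau\|^{1/\deg\tau}$ and the dilations $(\delta_r\mathbf M)^\tau=r^{\deg\tau}M^\tau$. The canonical lift $\mathbf h$ of $\mathrm h\in\mathrm H$ is obtained by inserting $\dot{\mathrm h}^j$ for $\Xi_j$ and recentring at $s$. The model space $\mathcal M$ is a set of models that is stable under dilations, contains all canonical lifts, and on which $\mathrm H$ acts by translations $T_{\mathrm h}$: $T_0=\mathrm{id}$, $T_{\mathrm h+\mathrm k}=T_{\mathrm h}T_{\mathrm k}$, $T_{\mathrm h}\mathbf k$ is the canonical lift of $\mathrm k+\mathrm h$, $T_{\mathrm h}$ shifts the path of a model by $\mathrm h$, $\delta_rT_{\mathrm h}=T_{r\mathrm h}\delta_r$, and $(\mathrm h,\mathbf M)\mapsto T_{\mathrm h}\mathbf M$ is continuous. A map $G:\mathcal M\to\mathbb R$ is *continuous linear* if $G(\mathbf M)=L(M)$ for a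 bounded linear functional $L$ on $C^\alpha$. It is *continuous quadratic* if it is continuous, bounded on $\{|||\mathbf M|||\le1\}$, and $G(T_{\mathrm k}\delta_r\mathbf M)=G(\mathbf k)+r\,B(M,\mathrm k)+r^2G(\mathbf M)$ for all $r\ge0$, $\mathrm k\in\mathrm H$, $\mathbf M\in\mathcal M$, with a bounded bilinear $B:C^\alpha\times\mathrm H\to\mathbb R$. **Assumptions.** Let $(X^\varepsilon)_{0<\varepsilon\le1}$ be $C([0,1],\mathbb R)$-valued random variables on $(\Omega,\mu)$, let $\bar\varepsilon=\bar\varepsilon(\varepsilon)\ge\varepsilon$ with $\bar\varepsilon\to0$ as $\varepsilon\to0$, put $\bar X^\varepsilon=(\bar\varepsilon/\varepsilon)X^\varepsilon$, and fix $x>0$. * (A1) $(\bar X^\varepsilon_1)$ satisfies a large deviation principle with speed $\bar\varepsilon^2$ and continuous rate function $\Lambda:\mathbb R\to[0,\infty]$. * (A2) $\limsup_{\varepsilon\to0}E[\exp(X^\varepsilon_1)^p]<\infty$ for some $p>1$. * (A3) There are a continuous map $\Phi:[0,1]\times\mathcal M\to C([0,1],\mathbb R)$, $(\varepsilon,\mathbf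 M)\mapsto\Phi^\varepsilon(\mathbf M)$, and a random model $\mathbf W=\mathbf W(\omega)$ in $\mathcal M$ whose path is $\omega$ a.s., such that $\bar X^\varepsilon=\Phi^\varepsilon(\delta_{\bar\varepsilon}\mathbf W)$ a.s. for each $\varepsilon\in(0,1]$. Moreover $\mathbf W$ is the limit in probability of $\mathfrak R_n(\mathbf W_n)$, where $\mathbf W_n$ is the canonical lift of $A_n\omega$; here $A_n:\Omega\to\mathrm H$ are continuous linear with $A_n\omega\to\omega$ uniformly whenever $\omega(0)=0$ and $A_n\mathrm h\to\mathrm h$ in $\mathrm H$ for $\mathrm h\in\mathrm H$ (e.g. mollifications), and the renormalizations $\mathfrak R_n:\mathcal M\to\mathcal M$ leave the path of a model unchanged and commute with translations. Finally $(\delta_{\bar\varepsilon}\mathbf W)$ satisfies a large deviation principle in $\mathcal M$ with speed $\bar\varepsilon^2$ and good rate function equal to $\tfrac12\|\mathrm h\|_{\mathrm H}^2$ at $\mathbf h$, $\mathrm h\in\mathrm H$, and $\infty$ elsewhere. * (A4a) For all $\mathrm h\in\mathrm H$, $r\in[0,1]$, $\mathbf M\in\mathcal M$: $\Phi^0_1(T_{\mathrm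 h}\delta_r\mathbf M)=\Phi^0_1(\mathbf h)+rG^{0,\mathrm h}_1(\mathbf M)+r^2G^{0,\mathrm h}_2(\mathbf M)+R^{0,\mathrm h,r}_3(\mathbf M)$ with $G^{0,\mathrm h}_1$ continuous linear, $G^{0,\mathrm h}_2$ continuous quadratic, $(\mathrm h,\mathbf M)\mapsto G_i^{0,\mathrm h}(\mathbf M)$ continuous for $i=1,2$, and, uniformly over bounded $\mathrm h$, for some $\delta>0$: $|R^{0,\mathrm h,r}_3(\mathbf M)|\le o(r^2)+O(r^3|||\mathbf M|||^3)$ whenever $r|||\mathbf M|||\le\delta$. * (A4b) For all $\mathrm h\in\mathrm H$, $\varepsilon\in(0,1]$, $\mathbf M\in\mathcal M$: $\Phi^\varepsilon_1(T_{\mathrm h}\delta_{\bar\varepsilon}\mathbf M)=\Phi^0_1(\mathbf h)+\bar\varepsilon G^{\mathrm h}_1(\mathbf M)+\bar\varepsilon^2G^{\mathrm h}_2(\mathbf M)+R^{\mathrm h,\varepsilon}_3(\mathbf M)$, with the same remainder estimate (for $r=\bar\varepsilon$), $G^{\mathrm h}_1=G^{0,\mathrm h}_1$ and $G^{\mathrm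 h}_2=G^{0,\mathrm h}_2+K_2(\mathrm h)$ for a constant $K_2(\mathrm h)\in\mathbb R$. * (A5) Put $\Phi_1(\mathrm h)=\Phi^0_1(\mathbf h)$. There is $\mathrm h^x\in\mathrm H$ with $\Phi_1(\mathrm h^x)=x$ which is the unique element of minimal norm of $\{\Phi_1=x\}$, and $\Lambda(x)=\tfrac12\|\mathrm h^x\|_{\mathrm H}^2$; $D\Phi_1(\mathrm h^x):\mathrm H\to\mathbb R$ is surjective; and, for $q$ with $\mathrm h^x=D\Phi_1(\mathrm h^x)^*q$, one has $q\,D^2\Phi_1(\mathrm h^x)[\mathrm k,\mathrm k]<\|\mathrm k\|_{\mathrm H}^2$ for all $0\ne\mathrm k\in\ker D\Phi_1(\mathrm h^x)$. **Theorem 5.1.** Assume (A1)–(A5) for fixed $x>0$. Let $k_\varepsilon=x\,\varepsilon/\bar\varepsilon$, $c(\varepsilon^2,k)=E[(\exp(X^\varepsilon_1)-\exp(k))^+]\in[0,\infty]$, and $$g^x_1=G^{\mathrm h^x}_1(\mathbf W),\qquad g^x_2=G^{\mathrm h^x}_2(\mathbf W),\qquad r^{\varepsilon,x}_3=R^{\mathrm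 h^x,\varepsilon}_3(\mathbf W).$$ Then $\Lambda$ is differentiable at $x$ and, for every $\varepsilon\in(0,1]$, $$c(\varepsilon^2,k_\varepsilon)=\exp\Big(-\frac{\Lambda(x)}{\bar\varepsilon^2}\Big)e^{k_\varepsilon}J(\varepsilon,x),\qquad J(\varepsilon,x)=E\Big[\exp\Big(-\frac{\Lambda'(x)g^x_1}{\bar\varepsilon}\Big)\Big(\exp\big(\varepsilon g^x_1+\bar\varepsilon\varepsilon g^x_2+(\varepsilon/\bar\varepsilon)r^{\varepsilon,x}_3\big)-1\Big)^+\Big],$$ where both sides are finite for all sufficiently small $\varepsilon$. Moreover $g^x_1$ is a centred Gaussian random variable whose variance $\sigma_x^2$ satisfies $\Lambda'(x)^2\sigma_x^2=2\Lambda(x)$; if $\Lambda(x)\neq0$, then $\Lambda'(x)\ne0$ and $$\sigma_x^2=\frac{2\Lambda(x)}{\Lambda'(x)^2}.$$ -/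

import Mathlib

open MeasureTheory ProbabilityTheory Filter Set Topology
open scoped ENNReal NNReal unitInterval

/-! ### Wiener space and Cameron-Martin space -/

/-- Continuous paths on `[0,1]` with values in `ℝ^m` (uniform norm). -/
abbrev PathSpace (m : ℕ) : Type := C(I, EuclideanSpace ℝ (Fin m))

instance instMeasurableSpacePathSpace (m : ℕ) : MeasurableSpace (PathSpace m) :=
  borel (PathSpace m)

instance instBorelSpacePathSpace (m : ℕ) : BorelSpace (PathSpace m) := ⟨rfl⟩

/-- Wiener measure: the centred Gaussian measure on path space under which the components are
independent with covariance `min s t`, i.e. the law of `m`-dimensional standard Brownian motion. -/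
structure IsWienerMeasure {m : ℕ} (μ : Measure (PathSpace m)) : Prop where
  gaussian : IsGaussian μ
  mean : ∀ (t : I) (i : Fin m), ∫ ω, ω t i ∂μ = 0
  cov : ∀ (s t : I) (i j : Fin m),
    ∫ ω, ω s i * ω t j ∂μ = if i = j then min (s : ℝ) (t : ℝ) else 0

/-- The Cameron-Martin space. A path is represented by its derivative in `L²([0,1], ℝ^m)`,
so the norm of the path is the `L²`-norm of the derivative. -/
abbrev CameronMartin (m : ℕ) : Type := Lp (EuclideanSpace ℝ (Fin m)) 2 (volume : Measure I)

theorem CameronMartin.integrable {m : ℕ} (h : CameronMartin m) :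
    Integrable (h : I → EuclideanSpace ℝ (Fin m)) (volume : Measure I) :=
  (Lp.memLp h).integrable (by norm_num)

theorem CameronMartin.continuous_primitive {m : ℕ} (h : CameronMartin m) :
    Continuous fun t : I => ∫ s in Set.Iic t, h s := by
  have hEq : (fun t : I => ∫ s in Set.Iic t, h s)
      = fun t : I => ∫ s, (Set.Iic t).indicator (h : I → EuclideanSpace ℝ (Fin m)) s := by
    funext t
    rw [integral_indicator measurableSet_Iic]
  rw [hEq, continuous_iff_continuousAt]
  intro t
  refine continuousAt_of_dominated (bound := fun s => ‖h s‖) ?_ ?_ h.integrable.norm ?_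
  · exact Eventually.of_forall fun u =>
      h.integrable.aestronglyMeasurable.indicator measurableSet_Iic
  · exact Eventually.of_forall fun u => Eventually.of_forall fun s =>
      norm_indicator_le_norm_self _ _
  · have hne : ∀ᵐ s : I ∂volume, s ≠ t := by
      rw [ae_iff]; simp
    filter_upwards [hne] with s hs
    rcases lt_or_gt_of_ne hs with hlt | hgt
    · refine ContinuousAt.congr (f := fun _ => h s) continuousAt_const ?_
      filter_upwards [lt_mem_nhds hlt] with u hu
      rw [Set.indicator_of_mem (Set.mem_Iic.2 hu.le)]
    · refine ContinuousAt.congr (f := fun _ => 0) continuousAt_const ?_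
      filter_upwards [gt_mem_nhds hgt] with u hu
      rw [Set.indicator_of_notMem (by simpa using hu)]

/-- The Cameron-Martin path `t ↦ ∫₀ᵗ ḣ(s) ds`. -/
noncomputable def cmPath {m : ℕ} (h : CameronMartin m) : PathSpace m :=
  ⟨fun t => ∫ s in Set.Iic t, h s, h.continuous_primitive⟩

/-! ### Hölder spaces -/

/-- Pairs of times `0 ≤ s < t ≤ 1`. -/
abbrev TimePair : Type := {p : I × I // p.1 < p.2}

/-- The length `t - s > 0`. -/
noncomputable def TimePair.len (p : TimePair) : ℝ := (p.1.2 : ℝ) - (p.1.1 : ℝ)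

theorem TimePair.len_pos (p : TimePair) : 0 < p.len := sub_pos.2 p.2

instance TimePair.instNonempty : Nonempty TimePair := ⟨⟨(0, 1), by simp⟩⟩

/-- The Hölder size `sup_{s<t} |f(s,t)| / (t-s)^a` of a two-parameter function. -/
noncomputable def holderSize (a : ℝ) (f : TimePair → ℝ) : ℝ := ⨆ p, |f p| / p.len ^ a

/-- The two-parameter functions with finite Hölder size. -/
def HolderBounded (a : ℝ) (f : TimePair → ℝ) : Prop := ∃ C : ℝ, ∀ p, |f p| ≤ C * p.len ^ a

theorem HolderBounded.bddAbove {a : ℝ} {f : TimePair → ℝ} (hf : HolderBounded a f) :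
    BddAbove (Set.range fun p => |f p| / p.len ^ a) := by
  obtain ⟨C, hC⟩ := hf
  refine ⟨C, ?_⟩
  rintro _ ⟨p, rfl⟩
  exact (div_le_iff₀ (Real.rpow_pos_of_pos p.len_pos a)).2 (hC p)

theorem HolderBounded.le_holderSize {a : ℝ} {f : TimePair → ℝ} (hf : HolderBounded a f)
    (p : TimePair) : |f p| / p.len ^ a ≤ holderSize a f :=
  le_ciSup hf.bddAbove p

theorem HolderBounded.sub {a : ℝ} {f g : TimePair → ℝ} (hf : HolderBounded a f)
    (hg : HolderBounded a g) : HolderBounded a fun p => f p - g p := by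
  obtain ⟨C, hC⟩ := hf
  obtain ⟨D, hD⟩ := hg
  refine ⟨C + D, fun p => ?_⟩
  rw [add_mul]
  exact (abs_sub _ _).trans (add_le_add (hC p) (hD p))

theorem HolderBounded.const_mul {a : ℝ} {f : TimePair → ℝ} (hf : HolderBounded a f) (c : ℝ) :
    HolderBounded a fun p => c * f p := by
  obtain ⟨C, hC⟩ := hf
  refine ⟨|c| * C, fun p => ?_⟩
  rw [abs_mul, mul_assoc]
  exact mul_le_mul_of_nonneg_left (hC p) (abs_nonneg c)

/-- The space `C^a` of `a`-Hölder paths started at the origin. -/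
def HolderPath (a : ℝ) (m : ℕ) : Submodule ℝ (PathSpace m) where
  carrier := {w | w 0 = 0 ∧ ∃ C : ℝ, ∀ p : TimePair, ‖w p.1.2 - w p.1.1‖ ≤ C * p.len ^ a}
  zero_mem' := ⟨rfl, 0, fun p => by simp⟩
  add_mem' := by
    rintro v w ⟨hv, C, hC⟩ ⟨hw, D, hD⟩
    refine ⟨by simp [hv, hw], C + D, fun p => ?_⟩
    have : (v + w) p.1.2 - (v + w) p.1.1 = (v p.1.2 - v p.1.1) + (w p.1.2 - w p.1.1) := by
      simp only [ContinuousMap.add_apply]; abel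
    rw [this, add_mul]
    exact (norm_add_le _ _).trans (add_le_add (hC p) (hD p))
  smul_mem' := by
    rintro c w ⟨hw, C, hC⟩
    refine ⟨by simp [hw], |c| * C, fun p => ?_⟩
    have : (c • w) p.1.2 - (c • w) p.1.1 = c • (w p.1.2 - w p.1.1) := by
      simp only [ContinuousMap.smul_apply, smul_sub]
    rw [this, norm_smul, Real.norm_eq_abs, mul_assoc]
    exact mul_le_mul_of_nonneg_left (hC p) (abs_nonneg c)

/-- The `a`-Hölder norm of a path started at the origin. -/
noncomputable def holderNorm {a : ℝ} {m : ℕ} (w : HolderPath a m) : ℝ :=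
  ⨆ p : TimePair, ‖w.1 p.1.2 - w.1 p.1.1‖ / p.len ^ a

/-! ### Symbols and models -/

/-- Hurst parameters `H ∈ (0, 1/2]`. -/
abbrev Hurst : Type := Set.Ioc (0 : ℝ) (1 / 2)

/-- The kernel `K^H(u, t) = √(2H) |t - u|^(H - 1/2)`, used for `u < t`. -/
noncomputable def volterraKernel (H : Hurst) (u t : I) : ℝ :=
  Real.sqrt (2 * (H : ℝ)) * |(t : ℝ) - (u : ℝ)| ^ ((H : ℝ) - 1 / 2)

/-- Symbols of a regularity structure: `xi j` is the `j`-th component of white noise, `integ H τ`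
is (recentred) convolution of `τ` with `K^H`, and `mul` is the product. Since convolution with
`K^(1/2)` is indefinite integration, `integ 1/2 (xi j)` stands for the `j`-th component of
Brownian motion, `integ H (xi j)` for its fractional version, and `integ 1/2 (mul (xi j) τ)` for
the iterated integral `∫ τ dW^j`. -/
inductive NoiseSymbol (m : ℕ) : Type
  | xi (j : Fin m) : NoiseSymbol m
  | integ (H : Hurst) (τ : NoiseSymbol m) : NoiseSymbol m
  | mul (τ υ : NoiseSymbol m) : NoiseSymbol m

namespace NoiseSymbol

/-- The number of noises in a symbol. -/
def deg {m : ℕ} : NoiseSymbol m → ℕ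
  | xi _ => 1
  | integ _ τ => τ.deg
  | mul τ υ => τ.deg + υ.deg

/-- The homogeneity of a symbol: `-1/2 - κ` for a noise, convolution with `K^H` adds `1/2 + H`,
and products are additive. -/
noncomputable def hom {m : ℕ} (κ : ℝ) : NoiseSymbol m → ℝ
  | xi _ => -(1 / 2) - κ
  | integ H τ => τ.hom κ + (1 / 2 + (H : ℝ))
  | mul τ υ => τ.hom κ + υ.hom κ

/-- Symbols that stand for functions: products of convolutions. -/
def IsFunction {m : ℕ} : NoiseSymbol m → Prop
  | xi _ => False
  | integ _ _ => True
  | mul τ υ => τ.IsFunction ∧ υ.IsFunction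

/-- The symbol of the `j`-th component of Brownian motion. -/
noncomputable def noise {m : ℕ} (j : Fin m) : NoiseSymbol m := integ ⟨1 / 2, by norm_num, le_refl _⟩ (xi j)

/-- The canonical realization of the symbols, driven by the Cameron-Martin path `h` and recentred
at time `s`, as functions of the time `t`. -/
noncomputable def canonical {m : ℕ} (h : CameronMartin m) : NoiseSymbol m → I → I → ℝ
  | xi j, _, t => (h : I → EuclideanSpace ℝ (Fin m)) t j
  | integ H τ, s, t =>
      (∫ u in Set.Iio t, volterraKernel H u t * canonical h τ s u)
        - ∫ u in Set.Iio s, volterraKernel H u s * canonical h τ s u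
  | mul τ υ, s, t => canonical h τ s t * canonical h υ s t

end NoiseSymbol

/-- The finite set of symbols, and the parameter `κ`, on which models are built; the symbols of
the Brownian components are among them. (For rough paths these are the symbols of the components
of `W` and of `∫ W ⊗ dW`; for rough volatility those of `W`, its fractional version `Ŵ`, and the
integrals of powers of `Ŵ`.) -/
structure SymbolSet (m : ℕ) where
  symbols : Finset (NoiseSymbol m)
  kappa : ℝ
  kappa_pos : 0 < kappa
  kappa_lt : kappa < 1 / 2
  noise_mem : ∀ j, NoiseSymbol.noise j ∈ symbols
  isFunction : ∀ τ ∈ symbols, τ.IsFunction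
  hom_pos : ∀ τ ∈ symbols, 0 < τ.hom kappa

/-- The Hölder exponent `1/2 - κ` of the driving noise. -/
noncomputable def SymbolSet.alpha {m : ℕ} (S : SymbolSet m) : ℝ := 1 / 2 - S.kappa

/-- A tuple of two-parameter functions indexed by the symbols, with Hölder regularity given by the
homogeneities, enhancing a path (whose increments are the components of lowest order). -/
@[ext]
structure Model {m : ℕ} (S : SymbolSet m) where
  path : PathSpace m
  comp : S.symbols → TimePair → ℝ
  path_zero : path 0 = 0
  comp_noise : ∀ (j : Fin m) (p : TimePair),
    comp ⟨NoiseSymbol.noise j, S.noise_mem j⟩ p = path p.1.2 j - path p.1.1 j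
  bounded : ∀ τ : S.symbols, HolderBounded (τ.1.hom S.kappa) (comp τ)

namespace Model

variable {m : ℕ} {S : SymbolSet m}

/-- The inhomogeneous distance of models. -/
noncomputable instance instDist : Dist (Model S) :=
  ⟨fun M N => ∑ τ, holderSize (τ.1.hom S.kappa) fun p => M.comp τ p - N.comp τ p⟩

theorem dist_def (M N : Model S) :
    dist M N = ∑ τ, holderSize (τ.1.hom S.kappa) fun p => M.comp τ p - N.comp τ p := rfl

theorem holderSize_nonneg (a : ℝ) (f : TimePair → ℝ) : 0 ≤ holderSize a f :=
  Real.iSup_nonneg fun p => div_nonneg (abs_nonneg _) (Real.rpow_nonneg p.len_pos.le _)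

theorem path_eq_of_comp_eq {M N : Model S} (h : M.comp = N.comp) : M.path = N.path := by
  ext t j
  rcases eq_or_lt_of_le (unitInterval.nonneg' : (0 : I) ≤ t) with h0 | h0
  · rw [← h0, M.path_zero, N.path_zero]
  · have hM := M.comp_noise j ⟨(0, t), h0⟩
    have hN := N.comp_noise j ⟨(0, t), h0⟩
    rw [h, hN] at hM
    simpa [M.path_zero, N.path_zero] using hM.symm

noncomputable instance instMetricSpace : MetricSpace (Model S) where
  dist_self M := by simp [dist_def, holderSize]
  dist_comm M N := by
    simp only [dist_def, holderSize, abs_sub_comm]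
  dist_triangle M N P := by
    simp only [dist_def]
    rw [← Finset.sum_add_distrib]
    refine Finset.sum_le_sum fun τ _ => ciSup_le fun p => ?_
    refine le_trans ?_ (add_le_add
      (((M.bounded τ).sub (N.bounded τ)).le_holderSize p)
      (((N.bounded τ).sub (P.bounded τ)).le_holderSize p))
    rw [← add_div]
    exact div_le_div_of_nonneg_right (abs_sub_le _ _ _) (Real.rpow_nonneg p.len_pos.le _)
  eq_of_dist_eq_zero := by
    intro M N h
    have hcomp : M.comp = N.comp := by
      funext τ p
      rw [dist_def, Finset.sum_eq_zero_iff_of_nonneg fun τ _ => holderSize_nonneg _ _] at h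
      have h1 := ((M.bounded τ).sub (N.bounded τ)).le_holderSize p
      rw [h τ (Finset.mem_univ _)] at h1
      have hpos := Real.rpow_pos_of_pos p.len_pos (τ.1.hom S.kappa)
      have h2 : |M.comp τ p - N.comp τ p| ≤ 0 := by
        by_contra hc
        exact absurd h1 (not_le.2 (div_pos (not_le.1 hc) hpos))
      exact sub_eq_zero.1 (abs_nonpos_iff.1 h2)
    exact Model.ext (path_eq_of_comp_eq hcomp) hcomp

/-- The homogeneous model norm `|||M|||`: each component contributes its Hölder size to the power
one over its number of noises. -/
noncomputable def homNorm (M : Model S) : ℝ :=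
  ∑ τ : S.symbols, holderSize (τ.1.hom S.kappa) (M.comp τ) ^ (1 / (τ.1.deg : ℝ))

/-- Dilation `δ_r`: every noise is multiplied by `r`. -/
noncomputable def dil (r : ℝ) (M : Model S) : Model S where
  path := r • M.path
  comp τ p := r ^ τ.1.deg * M.comp τ p
  path_zero := by simp [M.path_zero]
  comp_noise j p := by
    have hdeg : (NoiseSymbol.noise j).deg = 1 := rfl
    simp only [hdeg, M.comp_noise, pow_one, ContinuousMap.smul_apply, PiLp.smul_apply, smul_eq_mul,
      mul_sub]
  bounded τ := (M.bounded τ).const_mul _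

theorem path_mem (M : Model S) : M.path ∈ HolderPath S.alpha m := by
  refine ⟨M.path_zero, ?_⟩
  choose C hC using fun j : Fin m => M.bounded ⟨NoiseSymbol.noise j, S.noise_mem j⟩
  refine ⟨∑ j, C j, fun p => ?_⟩
  calc ‖M.path p.1.2 - M.path p.1.1‖
      ≤ ∑ j, ‖(M.path p.1.2 - M.path p.1.1) j‖ := by
        have h1 := EuclideanSpace.norm_eq (M.path p.1.2 - M.path p.1.1)
        rw [h1]
        refine Real.sqrt_le_iff.2 ⟨Finset.sum_nonneg fun j _ => norm_nonneg _, ?_⟩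
        exact Finset.sum_sq_le_sq_sum_of_nonneg fun j _ => norm_nonneg _
    _ ≤ ∑ j, C j * p.len ^ S.alpha := by
        refine Finset.sum_le_sum fun j _ => ?_
        have h2 := hC j p
        rw [M.comp_noise j p] at h2
        have h3 : (NoiseSymbol.noise j).hom S.kappa = S.alpha := by
          simp only [NoiseSymbol.noise, NoiseSymbol.hom, SymbolSet.alpha]; ring
        rw [h3] at h2
        simpa [Real.norm_eq_abs] using h2
    _ = (∑ j, C j) * p.len ^ S.alpha := by rw [Finset.sum_mul]

/-- The underlying path of a model, as an element of `C^α`. -/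
noncomputable def holderPath (M : Model S) : HolderPath S.alpha m := ⟨M.path, M.path_mem⟩

end Model

/-- A space of models on which the Cameron-Martin space acts by translation. The carrier may be any
set of models (for instance the models that satisfy Chen's relations) which is stable under
dilation, contains the canonical lifts of all Cameron-Martin paths and is stable under the
translations; `trans h` is the lift of the shift of paths by `h` to models. -/
structure ModelSpace {m : ℕ} (S : SymbolSet m) where
  carrier : Set (Model S)
  dil_mem : ∀ (r : ℝ), ∀ M ∈ carrier, M.dil r ∈ carrier
  lift : CameronMartin m → carrier
  lift_path : ∀ h, (lift h).1.path = cmPath h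
  lift_comp : ∀ h (τ : S.symbols) (p : TimePair),
    (lift h).1.comp τ p = τ.1.canonical h p.1.1 p.1.2
  trans : CameronMartin m → carrier → carrier
  trans_path : ∀ h M, (trans h M).1.path = M.1.path + cmPath h
  trans_lift : ∀ h k, trans h (lift k) = lift (k + h)
  trans_zero : ∀ M, trans 0 M = M
  trans_add : ∀ h k M, trans (h + k) M = trans h (trans k M)
  dil_trans : ∀ (r : ℝ) h M, (trans h M).1.dil r
    = (trans (r • h) ⟨M.1.dil r, dil_mem r M.1 M.2⟩).1
  continuous_trans : Continuous fun q : CameronMartin m × carrier => trans q.1 q.2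

/-- The models in the carrier, with the model topology. -/
abbrev ModelSpace.Pt {m : ℕ} {S : SymbolSet m} (𝓜 : ModelSpace S) : Type := 𝓜.carrier

/-- Dilation on the model space. -/
noncomputable def ModelSpace.dil {m : ℕ} {S : SymbolSet m} (𝓜 : ModelSpace S) (r : ℝ)
    (M : 𝓜.Pt) : 𝓜.Pt := ⟨M.1.dil r, 𝓜.dil_mem r M.1 M.2⟩

/-! ### Large deviations -/

/-- The large deviation principle, as `ε ↓ 0`, for the family `Y ε` with speed `v ε` and rate
function `J`, i.e. `P[Y ε ∈ A] ≈ exp(- inf_A J / v ε)`. -/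
structure SatisfiesLDP {Ω E : Type} [MeasurableSpace Ω] [TopologicalSpace E] (μ : Measure Ω)
    (Y : ℝ → Ω → E) (v : ℝ → ℝ) (J : E → ℝ≥0∞) : Prop where
  lsc : LowerSemicontinuous J
  upper : ∀ F : Set E, IsClosed F →
    limsup (fun ε => ((v ε : ℝ) : EReal) * ENNReal.log (μ {ω | Y ε ω ∈ F})) (𝓝[>] (0 : ℝ))
      ≤ -((⨅ y ∈ F, J y : ℝ≥0∞) : EReal)
  lower : ∀ G : Set E, IsOpen G →
    -((⨅ y ∈ G, J y : ℝ≥0∞) : EReal)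
      ≤ liminf (fun ε => ((v ε : ℝ) : EReal) * ENNReal.log (μ {ω | Y ε ω ∈ G})) (𝓝[>] (0 : ℝ))

/-- The Schilder rate function: `½‖h‖²` at the canonical lift of `h`, and `∞` elsewhere. -/
noncomputable def schilderRate {m : ℕ} {S : SymbolSet m} (𝓜 : ModelSpace S) (M : 𝓜.Pt) : ℝ≥0∞ :=
  ⨅ (h : CameronMartin m) (_ : 𝓜.lift h = M), ENNReal.ofReal (‖h‖ ^ 2 / 2)

/-! ### The assumptions -/

/-- Large deviation assumption: with the scale `e = ε̄(ε)` (which satisfies `ε ≤ ε̄` and `ε̄ → 0`),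
the rescaled log-price `(ε̄/ε) X^ε` at time one satisfies a large deviation principle with
continuous rate function `Λ` and speed `ε̄²`. -/
structure LargeDeviationAssumption {m : ℕ} (μ : Measure (PathSpace m)) (e : ℝ → ℝ)
    (X : ℝ → PathSpace m → C(I, ℝ)) (Λ : ℝ → ℝ≥0∞) : Prop where
  le_scale : ∀ ε ∈ Set.Ioc (0 : ℝ) 1, ε ≤ e ε
  scale_tendsto : Tendsto e (𝓝[>] 0) (𝓝 0)
  ldp : SatisfiesLDP μ (fun ε ω => e ε / ε * X ε ω 1) (fun ε => e ε ^ 2) Λ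
  continuous_rate : Continuous Λ

/-- Moment assumption: for some `p > 1`, the `p`-th moments of `exp(X^ε_1)` have a finite
limsup. -/
def MomentAssumption {m : ℕ} (μ : Measure (PathSpace m)) (X : ℝ → PathSpace m → C(I, ℝ)) : Prop :=
  ∃ p : ℝ, 1 < p ∧
    limsup (fun ε => ∫⁻ ω, ENNReal.ofReal (Real.exp (X ε ω 1) ^ p) ∂μ) (𝓝[>] (0 : ℝ)) < ∞

/-- The random model `W` is the limit in probability, in the model metric, of renormalized
canonical lifts of Wong-Zakai approximations of Brownian motion. The approximations `A n` (for
instance mollifications) are linear and continuous, and approximate every continuous path started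
at the origin uniformly and every Cameron-Martin path in Cameron-Martin norm. A renormalization
does not change the underlying path and commutes with translations; it may be the identity. -/
def IsWongZakaiLimit {m : ℕ} {S : SymbolSet m} (𝓜 : ModelSpace S) (μ : Measure (PathSpace m))
    (W : PathSpace m → 𝓜.Pt) : Prop :=
  ∃ (A : ℕ → PathSpace m →L[ℝ] CameronMartin m) (ren : ℕ → 𝓜.Pt → 𝓜.Pt),
    (∀ ω : PathSpace m, ω 0 = 0 → Tendsto (fun n => cmPath (A n ω)) atTop (𝓝 ω)) ∧
    (∀ h : CameronMartin m, Tendsto (fun n => A n (cmPath h)) atTop (𝓝 h)) ∧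
    (∀ n M, (ren n M).1.path = M.1.path) ∧
    (∀ n h M, ren n (𝓜.trans h M) = 𝓜.trans h (ren n M)) ∧
    TendstoInMeasure μ (fun n ω => ren n (𝓜.lift (A n ω))) atTop W

/-- Robust representation: the rescaled log-price process is a continuous function of the dilated
random model which enhances Brownian motion, and the dilated random model satisfies a
Schilder-type large deviation principle in model topology with good rate function. -/
structure RobustAssumption {m : ℕ} {S : SymbolSet m} (𝓜 : ModelSpace S)
    (μ : Measure (PathSpace m)) (e : ℝ → ℝ) (X : ℝ → PathSpace m → C(I, ℝ))
    (Φ : ℝ → 𝓜.Pt → C(I, ℝ)) (W : PathSpace m → 𝓜.Pt) : Prop where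
  continuousOn : ContinuousOn (fun q : ℝ × 𝓜.Pt => Φ q.1 q.2) (Set.Icc 0 1 ×ˢ Set.univ)
  measurable : AEStronglyMeasurable W μ
  enhances : ∀ᵐ ω ∂μ, (W ω).1.path = ω
  representation : ∀ ε ∈ Set.Ioc (0 : ℝ) 1, ∀ᵐ ω ∂μ,
    (e ε / ε) • X ε ω = Φ ε (𝓜.dil (e ε) (W ω))
  wongZakai : IsWongZakaiLimit 𝓜 μ W
  schilder : SatisfiesLDP μ (fun ε ω => 𝓜.dil (e ε) (W ω)) (fun ε => e ε ^ 2) (schilderRate 𝓜)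
  good : ∀ c : ℝ≥0, IsCompact {M : 𝓜.Pt | schilderRate 𝓜 M ≤ c}

/-- `G` is continuous linear: a bounded linear functional of the underlying path in `C^α`. -/
def IsContinuousLinear {m : ℕ} {S : SymbolSet m} (𝓜 : ModelSpace S) (G : 𝓜.Pt → ℝ) : Prop :=
  ∃ L : HolderPath S.alpha m →ₗ[ℝ] ℝ,
    (∃ C : ℝ, ∀ w, |L w| ≤ C * holderNorm w) ∧ ∀ M : 𝓜.Pt, G M = L M.1.holderPath

/-- `G` is continuous quadratic. -/
def IsContinuousQuadratic {m : ℕ} {S : SymbolSet m} (𝓜 : ModelSpace S) (G : 𝓜.Pt → ℝ) : Prop :=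
  Continuous G ∧
  (∃ C : ℝ, ∀ M : 𝓜.Pt, M.1.homNorm ≤ 1 → |G M| ≤ C) ∧
  ∃ B : HolderPath S.alpha m →ₗ[ℝ] CameronMartin m →ₗ[ℝ] ℝ,
    (∃ C : ℝ, ∀ w k, |B w k| ≤ C * holderNorm w * ‖k‖) ∧
    ∀ (k : CameronMartin m) (r : ℝ), 0 ≤ r → ∀ M : 𝓜.Pt,
      G (𝓜.trans k (𝓜.dil r M)) = G (𝓜.lift k) + r * B M.1.holderPath k + r ^ 2 * G M

/-- Second order expansion of `Φ⁰_1(T_h δ_r M)` in the dilation parameter `r`, uniformly over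
bounded `h`, with coefficients `G₁` (continuous linear in `M`) and `G₂` (continuous quadratic in
`M`), and remainder `R` of size `o(r²) + O(r³ |||M|||³)` as long as `r |||M|||` is small. -/
structure TaylorAssumption {m : ℕ} {S : SymbolSet m} (𝓜 : ModelSpace S)
    (Φ : ℝ → 𝓜.Pt → C(I, ℝ)) (G₁ G₂ : CameronMartin m → 𝓜.Pt → ℝ)
    (R : CameronMartin m → ℝ → 𝓜.Pt → ℝ) : Prop where
  expansion : ∀ h, ∀ r ∈ Set.Icc (0 : ℝ) 1, ∀ M : 𝓜.Pt,
    Φ 0 (𝓜.trans h (𝓜.dil r M)) 1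
      = Φ 0 (𝓜.lift h) 1 + r * G₁ h M + r ^ 2 * G₂ h M + R h r M
  linear : ∀ h, IsContinuousLinear 𝓜 (G₁ h)
  quadratic : ∀ h, IsContinuousQuadratic 𝓜 (G₂ h)
  remainder : ∀ b : ℝ, ∃ δ > 0, ∃ (C : ℝ) (ρ : ℝ → ℝ),
    ρ =o[𝓝[>] 0] (fun r => r ^ 2) ∧
    ∀ h : CameronMartin m, ‖h‖ ≤ b → ∀ r ∈ Set.Ioc (0 : ℝ) 1, ∀ M : 𝓜.Pt,
      r * M.1.homNorm ≤ δ → |R h r M| ≤ ρ r + C * (r ^ 3 * M.1.homNorm ^ 3)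
  continuous_G₁ : Continuous fun q : CameronMartin m × 𝓜.Pt => G₁ q.1 q.2
  continuous_G₂ : Continuous fun q : CameronMartin m × 𝓜.Pt => G₂ q.1 q.2

/-- The corresponding expansion of `Φ^ε_1(T_h δ_ε̄ M)` along the scale `e = ε̄(ε)`. Compared with the
coefficients `G₁₀, G₂₀` of the expansion of `Φ⁰`, the first coefficient is the same and the second
one differs by a constant, i.e. a quantity that does not depend on the model. -/
structure PerturbedTaylorAssumption {m : ℕ} {S : SymbolSet m} (𝓜 : ModelSpace S) (e : ℝ → ℝ)
    (Φ : ℝ → 𝓜.Pt → C(I, ℝ)) (G₁₀ G₂₀ G₁ G₂ : CameronMartin m → 𝓜.Pt → ℝ)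
    (R : CameronMartin m → ℝ → 𝓜.Pt → ℝ) : Prop where
  expansion : ∀ h, ∀ ε ∈ Set.Ioc (0 : ℝ) 1, ∀ M : 𝓜.Pt,
    Φ ε (𝓜.trans h (𝓜.dil (e ε) M)) 1
      = Φ 0 (𝓜.lift h) 1 + e ε * G₁ h M + e ε ^ 2 * G₂ h M + R h ε M
  remainder : ∀ b : ℝ, ∃ δ > 0, ∃ (C : ℝ) (ρ : ℝ → ℝ),
    ρ =o[𝓝[>] 0] (fun ε => e ε ^ 2) ∧
    ∀ h : CameronMartin m, ‖h‖ ≤ b → ∀ ε ∈ Set.Ioc (0 : ℝ) 1, ∀ M : 𝓜.Pt,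
      e ε * M.1.homNorm ≤ δ → |R h ε M| ≤ ρ ε + C * (e ε ^ 3 * M.1.homNorm ^ 3)
  first : ∀ h M, G₁ h M = G₁₀ h M
  second : ∃ K₂ : CameronMartin m → ℝ, ∀ h M, G₂ h M = G₂₀ h M + K₂ h

/-- The control map `h ↦ Φ⁰_1(h)`, through the canonical lift. -/
noncomputable def controlMap {m : ℕ} {S : SymbolSet m} (𝓜 : ModelSpace S)
    (Φ : ℝ → 𝓜.Pt → C(I, ℝ)) (h : CameronMartin m) : ℝ := Φ 0 (𝓜.lift h) 1

/-- Control theoretic assumption at `x`, for a map `φ` on the Cameron-Martin space: `hx` is the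
unique control of minimal energy with `φ = x`, its energy is `Λ(x)`, the differential of `φ` at
`hx` is surjective, and `hx` is non-degenerate: for `q` with `hx = Dφ(hx)^* q`, the form
`q D²φ(hx)` is strictly below the identity, on the tangent space `ker Dφ(hx)` of the admissible
controls. -/
structure ControlAssumption {m : ℕ} (φ : CameronMartin m → ℝ) (Λ : ℝ → ℝ≥0∞) (x : ℝ)
    (hx : CameronMartin m) : Prop where
  admissible : φ hx = x
  unique_minimizer : ∀ h, φ h = x → h ≠ hx → ‖hx‖ < ‖h‖
  energy : Λ x = ENNReal.ofReal (‖hx‖ ^ 2 / 2)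
  surjective : Function.Surjective (fderiv ℝ φ hx)
  nondegenerate : ∀ q : ℝ, (∀ k, inner ℝ hx k = q * fderiv ℝ φ hx k) →
    ∀ k : CameronMartin m, fderiv ℝ φ hx k = 0 → k ≠ 0 →
      q * fderiv ℝ (fderiv ℝ φ) hx k k < ‖k‖ ^ 2

/-! ### Call prices -/

/-- The call price `c(ε², k) = E[(exp(X^ε_1) - exp(k))⁺]`, as an element of `[0, ∞]`. -/
noncomputable def callPrice {m : ℕ} (μ : Measure (PathSpace m)) (X : ℝ → PathSpace m → C(I, ℝ))
    (ε k : ℝ) : ℝ≥0∞ :=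
  ∫⁻ ω, ENNReal.ofReal (max (Real.exp (X ε ω 1) - Real.exp k) 0) ∂μ

/-- The expectation
`E[exp(- q g₁ / ε̄) (exp(ε g₁ + ε̄ ε g₂ + (ε / ε̄) r₃) - 1)⁺]` at scale `ε̄ = eb`, as an element of
`[0, ∞]`. -/
noncomputable def callFactor {Ω : Type} [MeasurableSpace Ω] (μ : Measure Ω) (q ε eb : ℝ)
    (g₁ g₂ r₃ : Ω → ℝ) : ℝ≥0∞ :=
  ∫⁻ ω, ENNReal.ofReal (Real.exp (-(q * g₁ ω) / eb) *
    max (Real.exp (ε * g₁ ω + eb * ε * g₂ ω + ε / eb * r₃ ω) - 1) 0) ∂μ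

/-- The real-valued version of a rate function. -/
noncomputable def realRate (Λ : ℝ → ℝ≥0∞) (y : ℝ) : ℝ := (Λ y).toReal

/-- The stochastic Taylor coefficient `ω ↦ G_h(W(ω))`. -/
def taylorCoeff {m : ℕ} {S : SymbolSet m} {𝓜 : ModelSpace S}
    (G : CameronMartin m → 𝓜.Pt → ℝ) (W : PathSpace m → 𝓜.Pt) (h : CameronMartin m)
    (ω : PathSpace m) : ℝ := G h (W ω)

/-- The stochastic Taylor remainder `ω ↦ R_{h,ε}(W(ω))`. -/
def taylorRemainder {m : ℕ} {S : SymbolSet m} {𝓜 : ModelSpace S}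
    (R : CameronMartin m → ℝ → 𝓜.Pt → ℝ) (W : PathSpace m → 𝓜.Pt) (h : CameronMartin m)
    (ε : ℝ) (ω : PathSpace m) : ℝ := R h ε (W ω)

/-!
Write `φ` for the control map `h ↦ Φ⁰₁(lift h)`, `D` for its differential at the minimizer `hx`, and
`g₁ = G₁(W)`.

*The rate function.* By the contraction principle (`rate_comp_le`, `exists_rate_lt_of_rate_lt`),
`Λ(y)` is the infimum of `‖h‖² / 2` over the controls with `φ h = y`. The Taylor expansion of `φ`
gives directional derivatives which are strict in the base point
(`TaylorAssumption.hasStrictDirDerivAt`), with `D k = G₁(lift k)` at `hx`. Moving along one direction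
`v` with `D v = 1` therefore corrects the level of any control near `hx`
(`HasStrictDirDerivAt.exists_step`). This gives Lagrange's condition `⟨hx, ·⟩ = q D` with
`q = ⟨hx, v⟩` (`inner_eq_zero_of_minimizer`) and, comparing energies at the levels `x` and `y` in both
directions, `Λ'(x) = q` (`hasDerivAt_realRate`). The second comparison needs near-minimizers at
levels near `x` to be close to `hx`. Their lifts are compact in the model topology, in which
`⟨hx, ·⟩ = q G₁(lift ·)` is continuous, and convergence of these inner products together with the
bound on the norms gives convergence in norm (`norm_sub_lt_of_near_minimizer`).

*The Gaussian variable.* `G₁` is continuous on models and sees only the path, so `g₁` is the almost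
sure limit of the continuous linear functionals `ω ↦ D (A n ω)` of the Gaussian path `ω`. Limits of
centred Gaussian variables are Gaussian (`map_eq_gaussianReal_of_tendsto_ae`), and the covariances
with `g₁` are those of the Wiener integral of the Riesz representer `l` of `D`
(`IsWienerMeasure.covariance_eq_apply_cmPath`). Hence `Var g₁ = ‖l‖²`, and since `hx = q l`,
`q² Var g₁ = ‖hx‖² = 2 Λ(x)`.

*The price formula.* Consequently `q g₁` is the Wiener integral of `hx`, and the Cameron–Martin
formula (`map_add_eq_withDensity`) describes the shift of Wiener measure by `hx / ē`. Shifting the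
path translates the random model (`ae_model_add_eq_trans`), so the expansion at `hx` applies to the
shifted log-price and the density contributes `exp (-q g₁ / ē - Λ(x) / ē²)`.
-/

/-! ### Gaussian limits and the Cameron–Martin formula -/

/-- Almost sure limits of centred real Gaussian variables are centred Gaussian, and the variances
converge. The characteristic functions `exp (-v_n t² / 2)` converge pointwise; at a point where the
limit does not vanish this determines the limit of `v_n`. -/
theorem map_eq_gaussianReal_of_tendsto_ae {Ω : Type*} [MeasurableSpace Ω] {P : Measure Ω}
    [IsProbabilityMeasure P] {Y : ℕ → Ω → ℝ} {Z : Ω → ℝ} (hY : ∀ n, HasGaussianLaw (Y n) P)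
    (h0 : ∀ n, ∫ ω, Y n ω ∂P = 0)
    (hlim : ∀ᵐ ω ∂P, Tendsto (fun n => Y n ω) atTop (𝓝 (Z ω))) :
    P.map Z = gaussianReal 0 (Var[Z; P]).toNNReal ∧
      Tendsto (fun n => Var[Y n; P]) atTop (𝓝 Var[Z; P]) := by
  have hYm : ∀ n, AEMeasurable (Y n) P := fun n => (hY n).aemeasurable
  have hZm : AEMeasurable Z P := aemeasurable_of_tendsto_metrizable_ae atTop hYm hlim
  have : IsProbabilityMeasure (P.map Z) := Measure.isProbabilityMeasure_map hZm
  have hψ : ∀ t : ℝ, Tendsto (fun n => charFun (P.map (Y n)) t) atTop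
      (𝓝 (charFun (P.map Z) t)) := by
    intro t
    simp_rw [charFun_apply_real]
    rw [integral_map hZm (by fun_prop)]
    have : ∀ n, ∫ x : ℝ, Complex.exp (t * x * Complex.I) ∂(P.map (Y n))
        = ∫ ω, Complex.exp (t * Y n ω * Complex.I) ∂P := fun n =>
      integral_map (hYm n) (by fun_prop)
    simp_rw [this]
    refine tendsto_integral_of_dominated_convergence (fun _ => (1 : ℝ)) ?_ (integrable_const _)
      ?_ ?_
    · intro n
      have := (hYm n).aestronglyMeasurable
      fun_prop
    · intro n
      refine Eventually.of_forall fun ω => le_of_eq ?_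
      rw [← Complex.ofReal_mul]
      exact Complex.norm_exp_ofReal_mul_I _
    · filter_upwards [hlim] with ω hω
      have hc : Continuous fun y : ℝ => Complex.exp (t * y * Complex.I) := by fun_prop
      exact (hc.tendsto _).comp hω
  have hch : ∀ n (t : ℝ), charFun (P.map (Y n)) t
      = ((Real.exp (-(Var[Y n; P] * t ^ 2 / 2)) : ℝ) : ℂ) := by
    intro n t
    rw [(hY n).map_eq_gaussianReal, charFun_gaussianReal, h0 n]
    push_cast [Real.coe_toNNReal _ (variance_nonneg _ _)]
    congr 1
    ring
  obtain ⟨t₀, ht₀, hne⟩ : ∃ t : ℝ, t ≠ 0 ∧ charFun (P.map Z) t ≠ 0 := by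
    have hc : ContinuousAt (charFun (P.map Z)) 0 := continuous_charFun.continuousAt
    have h1 : charFun (P.map Z) 0 ≠ 0 := by simp
    have h2 : ∀ᶠ t in 𝓝[≠] (0 : ℝ), charFun (P.map Z) t ≠ 0 :=
      (hc.eventually_ne h1).filter_mono nhdsWithin_le_nhds
    obtain ⟨t, ht, ht'⟩ := (h2.and self_mem_nhdsWithin).exists
    exact ⟨t, ht', ht⟩
  have hnorm : Tendsto (fun n => Real.exp (-(Var[Y n; P] * t₀ ^ 2 / 2))) atTop
      (𝓝 ‖charFun (P.map Z) t₀‖) := by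
    refine (hψ t₀).norm.congr fun n => ?_
    rw [hch, Complex.norm_real, Real.norm_eq_abs, abs_of_pos (Real.exp_pos _)]
  have hlog := hnorm.log (norm_ne_zero_iff.2 hne)
  simp only [Real.log_exp] at hlog
  set w : ℝ := Real.log ‖charFun (P.map Z) t₀‖ * (-2 / t₀ ^ 2) with hw
  have hvar : Tendsto (fun n => Var[Y n; P]) atTop (𝓝 w) := by
    refine (hlog.mul_const (-2 / t₀ ^ 2)).congr fun n => ?_
    field_simp
  have hw0 : 0 ≤ w := ge_of_tendsto' hvar fun n => variance_nonneg _ _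
  have hmap : P.map Z = gaussianReal 0 w.toNNReal := by
    refine Measure.ext_of_charFun ?_
    ext t
    rw [charFun_gaussianReal]
    have h1 : Tendsto (fun n => ((Real.exp (-(Var[Y n; P] * t ^ 2 / 2)) : ℝ) : ℂ)) atTop
        (𝓝 ((Real.exp (-(w * t ^ 2 / 2)) : ℝ) : ℂ)) := by
      refine (Complex.continuous_ofReal.tendsto _).comp ((Real.continuous_exp.tendsto _).comp ?_)
      exact ((hvar.mul_const _).div_const _).neg
    have h2 := tendsto_nhds_unique ((hψ t).congr fun n => hch n t) h1
    rw [h2]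
    push_cast [Real.coe_toNNReal _ hw0]
    congr 1
    ring
  have hZv : Var[Z; P] = w := by
    have h1 : Var[id; P.map Z] = Var[Z; P] := variance_id_map hZm
    rw [← h1, hmap, variance_id_gaussianReal, Real.coe_toNNReal _ hw0]
  rw [hZv]
  exact ⟨hmap, hvar⟩

section GaussianLimit

variable {E : Type*} [NormedAddCommGroup E] [NormedSpace ℝ E] [MeasurableSpace E] [BorelSpace E]
  {μ : Measure E} [IsGaussian μ] {a : ℕ → StrongDual ℝ E} {g : E → ℝ}

theorem hasGaussianLaw_strongDual (b : StrongDual ℝ E) : HasGaussianLaw (fun x => b x) μ :=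
  ⟨inferInstanceAs (IsGaussian (μ.map b))⟩

/-- A continuous linear functional and a limit of such functionals are jointly Gaussian. -/
theorem hasGaussianLaw_prodMk_of_tendsto (h0 : ∀ b : StrongDual ℝ E, ∫ x, b x ∂μ = 0)
    (hlim : ∀ᵐ x ∂μ, Tendsto (fun n => a n x) atTop (𝓝 (g x))) (b : StrongDual ℝ E) :
    HasGaussianLaw (fun x => (b x, g x)) μ := by
  have hgm : AEMeasurable g μ := aemeasurable_of_tendsto_metrizable_ae atTop
    (fun n => (a n).continuous.measurable.aemeasurable) hlim
  have hm : AEMeasurable (fun x => (b x, g x)) μ :=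
    b.continuous.measurable.aemeasurable.prodMk hgm
  refine ⟨isGaussian_of_map_eq_gaussianReal fun L => ⟨0, Var[L ∘ fun x => (b x, g x); μ].toNNReal, ?_⟩⟩
  rw [AEMeasurable.map_map_of_aemeasurable (by fun_prop) hm]
  have hL : ∀ u v : ℝ, L (u, v) = L (1, 0) * u + L (0, 1) * v := by
    intro u v
    have : ((u, v) : ℝ × ℝ) = u • (1, 0) + v • (0, 1) := by simp
    rw [this, map_add, map_smul, map_smul, smul_eq_mul, smul_eq_mul]
    ring
  refine (map_eq_gaussianReal_of_tendsto_ae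
    (Y := fun n x => (L (1, 0) • b + L (0, 1) • a n : StrongDual ℝ E) x)
    (fun n => hasGaussianLaw_strongDual _) (fun n => h0 _) ?_).1
  filter_upwards [hlim] with x hx
  rw [Function.comp_apply, hL (b x) (g x)]
  simpa using (tendsto_const_nhds (x := L (1, 0) * b x)).add (hx.const_mul (L (0, 1)))

theorem hasGaussianLaw_of_tendsto (h0 : ∀ b : StrongDual ℝ E, ∫ x, b x ∂μ = 0)
    (hlim : ∀ᵐ x ∂μ, Tendsto (fun n => a n x) atTop (𝓝 (g x))) : HasGaussianLaw g μ :=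
  (hasGaussianLaw_prodMk_of_tendsto h0 hlim 0).snd

theorem covariance_tendsto (h0 : ∀ b : StrongDual ℝ E, ∫ x, b x ∂μ = 0)
    (hlim : ∀ᵐ x ∂μ, Tendsto (fun n => a n x) atTop (𝓝 (g x))) (b : StrongDual ℝ E) :
    Tendsto (fun n => cov[fun x => b x, fun x => a n x; μ]) atTop
      (𝓝 cov[fun x => b x, g; μ]) := by
  have hg := (hasGaussianLaw_of_tendsto h0 hlim).memLp_two
  have hb : ∀ b : StrongDual ℝ E, MemLp (fun x => b x) 2 μ := fun b =>
    (hasGaussianLaw_strongDual b).memLp_two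
  have h1 := (map_eq_gaussianReal_of_tendsto_ae (fun n => hasGaussianLaw_strongDual (a n))
    (fun n => h0 _) hlim).2
  have h2 := (map_eq_gaussianReal_of_tendsto_ae
    (fun n => hasGaussianLaw_strongDual (b + a n)) (fun n => h0 _)
    (Z := fun x => b x + g x) (by
      filter_upwards [hlim] with x hx
      exact tendsto_const_nhds.add hx)).2
  have e1 : ∀ n, cov[fun x => b x, fun x => a n x; μ]
      = (Var[fun x => (b + a n) x; μ] - Var[fun x => b x; μ] - Var[fun x => a n x; μ]) / 2 := by
    intro n
    have := variance_add (hb b) (hb (a n))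
    have h3 : (fun x => (b + a n) x) = (fun x => b x) + fun x => a n x := rfl
    rw [h3, this]; ring
  have e2 : cov[fun x => b x, g; μ]
      = (Var[fun x => b x + g x; μ] - Var[fun x => b x; μ] - Var[g; μ]) / 2 := by
    have := variance_add (hb b) hg
    have h3 : (fun x => b x + g x) = (fun x => b x) + g := rfl
    rw [h3, this]; ring
  simp_rw [e1, e2]
  exact ((h2.sub tendsto_const_nhds).sub h1).div_const 2

/-- The variance of the limit is the limit of the covariances of the limit with the approximations:
`g - a n` is itself Gaussian and tends to zero, so its variance tends to zero. -/
theorem covariance_limit_tendsto_variance (h0 : ∀ b : StrongDual ℝ E, ∫ x, b x ∂μ = 0)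
    (hlim : ∀ᵐ x ∂μ, Tendsto (fun n => a n x) atTop (𝓝 (g x))) :
    Tendsto (fun n => cov[fun x => a n x, g; μ]) atTop (𝓝 Var[g; μ]) := by
  have hg := (hasGaussianLaw_of_tendsto h0 hlim).memLp_two
  have hb : ∀ b : StrongDual ℝ E, MemLp (fun x => b x) 2 μ := fun b =>
    (hasGaussianLaw_strongDual b).memLp_two
  have h1 := (map_eq_gaussianReal_of_tendsto_ae (fun n => hasGaussianLaw_strongDual (a n))
    (fun n => h0 _) hlim).2
  have hd : ∀ n, HasGaussianLaw (fun x => g x - a n x) μ ∧ ∫ x, (g x - a n x) ∂μ = 0 := by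
    intro n
    have hl : ∀ᵐ x ∂μ, Tendsto (fun k => (a k - a n) x) atTop (𝓝 (g x - a n x)) := by
      filter_upwards [hlim] with x hx
      exact hx.sub tendsto_const_nhds
    have hG := hasGaussianLaw_of_tendsto h0 hl
    refine ⟨hG, ?_⟩
    have hmap := (map_eq_gaussianReal_of_tendsto_ae
      (fun k => hasGaussianLaw_strongDual (a k - a n)) (fun k => h0 _) hl).1
    have := integral_map (f := fun y : ℝ => y) hG.aemeasurable (by fun_prop)
    rw [← this, hmap, integral_id_gaussianReal]
  have h2 := (map_eq_gaussianReal_of_tendsto_ae (fun n => (hd n).1) (fun n => (hd n).2)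
    (Z := fun _ => 0) (by
      filter_upwards [hlim] with x hx
      simpa using (tendsto_const_nhds (x := g x)).sub hx)).2
  have e1 : ∀ n, cov[fun x => a n x, g; μ]
      = (Var[g; μ] + Var[fun x => a n x; μ] - Var[fun x => g x - a n x; μ]) / 2 := by
    intro n
    have := variance_sub hg (hb (a n))
    have h3 : (fun x => g x - a n x) = g - fun x => a n x := rfl
    rw [h3, this, covariance_comm]; ring
  simp_rw [e1]
  have h3 := ((tendsto_const_nhds (x := Var[g; μ])).add h1).sub h2
  have h4 := h3.div_const 2
  have h5 : Var[fun _ : E => (0 : ℝ); μ] = 0 := variance_zero μ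
  rw [h5] at h4
  simpa using h4

/-- **Cameron–Martin formula.** If `g` is a limit of continuous linear functionals and the vector
`ξ` represents the covariances with `g`, then the shift of `μ` by `ξ` has density
`exp (g - Var g / 2)`. For a functional `b`, write `b = b' + κ g` with `b'` independent of `g`, and
compare characteristic functions. -/
theorem map_add_eq_withDensity [SecondCountableTopology E] [CompleteSpace E]
    (h0 : ∀ b : StrongDual ℝ E, ∫ x, b x ∂μ = 0)
    (hlim : ∀ᵐ x ∂μ, Tendsto (fun n => a n x) atTop (𝓝 (g x))) {ξ : E}
    (hξ : ∀ b : StrongDual ℝ E, cov[fun x => b x, g; μ] = b ξ) :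
    μ.map (fun x => x + ξ)
      = μ.withDensity fun x => ENNReal.ofReal (Real.exp (g x - Var[g; μ] / 2)) := by
  have hg := hasGaussianLaw_of_tendsto h0 hlim
  have hgmap := (map_eq_gaussianReal_of_tendsto_ae (fun n => hasGaussianLaw_strongDual (a n))
    (fun n => h0 _) hlim).1
  have hgm := hg.aemeasurable
  have hb : ∀ b : StrongDual ℝ E, MemLp (fun x => b x) 2 μ := fun b =>
    (hasGaussianLaw_strongDual b).memLp_two
  have hint : Integrable (fun x => Real.exp (g x - Var[g; μ] / 2)) μ := by
    simp_rw [sub_eq_add_neg, Real.exp_add]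
    refine Integrable.mul_const ?_ _
    have h1 := integrable_exp_mul_gaussianReal (μ := 0) (v := (Var[g; μ]).toNNReal) 1
    rw [← hgmap] at h1
    simpa [Function.comp_def] using (integrable_map_measure (by fun_prop) hgm).1 h1
  have : IsFiniteMeasure
      (μ.withDensity fun x => ENNReal.ofReal (Real.exp (g x - Var[g; μ] / 2))) :=
    isFiniteMeasure_withDensity_ofReal hint.2
  refine Measure.ext_of_charFunDual ?_
  ext b
  rw [charFunDual_map_add_const, IsGaussian.charFunDual_eq, charFunDual_apply,
    integral_withDensity_eq_integral_toReal_smul₀ (by fun_prop) (by simp)]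
  set τ := Var[g; μ] with hτ
  set c := cov[fun x => b x, g; μ] with hc
  set κ : ℝ := c / τ with hκ
  have hκτ : κ * τ = c := by
    by_cases h : τ = 0
    · have h2 : evariance g μ = 0 := by
        rw [← hg.memLp_two.ofReal_variance_eq, ← hτ, h, ENNReal.ofReal_zero]
      have h3 := (evariance_eq_zero_iff hgm).1 h2
      rw [h, mul_zero, hc, covariance]
      refine (integral_eq_zero_of_ae ?_).symm
      filter_upwards [h3] with x hx
      simp [hx]
    · rw [hκ]; field_simp
  set b' : E → ℝ := fun x => b x - κ * g x with hb'
  have hpair : HasGaussianLaw (fun x => (b' x, g x)) μ := by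
    have := (hasGaussianLaw_prodMk_of_tendsto h0 hlim b).map_fun
      ((ContinuousLinearMap.fst ℝ ℝ ℝ - κ • ContinuousLinearMap.snd ℝ ℝ ℝ).prod
        (ContinuousLinearMap.snd ℝ ℝ ℝ))
    simpa using this
  have hb'e : b' = (fun x => b x) - κ • g := by ext x; simp [hb']
  have hcov : cov[b', g; μ] = 0 := by
    rw [hb'e, covariance_sub_left (hb b) (hg.memLp_two.const_smul κ) hg.memLp_two,
      covariance_smul_left, covariance_self hgm, ← hc, ← hτ, hκτ, sub_self]
  have hind := hpair.indepFun_of_covariance_eq_zero hcov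
  have hvar' : Var[b'; μ] = Var[fun x => b x; μ] - κ * c := by
    rw [hb'e, variance_sub (hb b) (hg.memLp_two.const_smul κ), covariance_smul_right,
      variance_smul, ← hc, ← hτ, ← hκτ]
    ring
  have hb'm : ∫ x, b' x ∂μ = 0 := by
    have hg0 : ∫ x, g x ∂μ = 0 := by
      have := integral_map (f := fun y : ℝ => y) hgm (by fun_prop)
      rw [← this, hgmap, integral_id_gaussianReal]
    rw [hb', integral_sub ((hb b).integrable (by norm_num))
      ((hg.memLp_two.integrable (by norm_num)).const_mul _), h0, integral_const_mul, hg0]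
    simp
  have hE1 : ∫ x, Complex.exp (b' x * Complex.I) ∂μ = Complex.exp (-(Var[b'; μ] : ℂ) / 2) := by
    have h1 := complexMGF_gaussianReal (hpair.fst.map_eq_gaussianReal) Complex.I
    rw [hb'm, complexMGF] at h1
    simp_rw [mul_comm _ Complex.I]
    rw [h1, Real.coe_toNNReal _ (variance_nonneg _ _)]
    simp
  have hE2 : ∫ x, Complex.exp ((κ * Complex.I + 1) * g x) ∂μ
      = Complex.exp (τ * (κ * Complex.I + 1) ^ 2 / 2) := by
    have h1 := complexMGF_gaussianReal hgmap (κ * Complex.I + 1)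
    rw [complexMGF] at h1
    rw [h1, Real.coe_toNNReal _ (variance_nonneg _ _), ← hτ]
    simp
  have hprod : ∫ x, Complex.exp (b' x * Complex.I) * Complex.exp ((κ * Complex.I + 1) * g x) ∂μ
      = Complex.exp (-(Var[b'; μ] : ℂ) / 2) * Complex.exp (τ * (κ * Complex.I + 1) ^ 2 / 2) := by
    have hi := hind.comp (φ := fun y : ℝ => Complex.exp (y * Complex.I))
      (ψ := fun y : ℝ => Complex.exp ((κ * Complex.I + 1) * y)) (by fun_prop) (by fun_prop)
    have hm' := hpair.fst.aemeasurable
    rw [← hE1, ← hE2]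
    exact hi.integral_fun_mul_eq_mul_integral
      (by simp only [Function.comp_def]; exact AEMeasurable.aestronglyMeasurable (by fun_prop))
      (by simp only [Function.comp_def]; exact AEMeasurable.aestronglyMeasurable (by fun_prop))
  have hrew : ∀ x, (ENNReal.ofReal (Real.exp (g x - τ / 2))).toReal
        • Complex.exp (b x * Complex.I)
      = Complex.exp (-(τ : ℂ) / 2) * (Complex.exp (b' x * Complex.I)
        * Complex.exp ((κ * Complex.I + 1) * g x)) := by
    intro x
    rw [ENNReal.toReal_ofReal (Real.exp_pos _).le, Complex.real_smul, Complex.ofReal_exp,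
      ← Complex.exp_add, ← Complex.exp_add, ← Complex.exp_add]
    congr 1
    simp only [hb']
    push_cast
    ring
  simp_rw [hrew]
  rw [integral_const_mul, hprod, hvar', ← hξ b, ← hc, ← Complex.exp_add, ← Complex.exp_add,
    ← Complex.exp_add]
  have hz : ∫ x, (b x : ℂ) ∂μ = 0 := by
    rw [integral_complex_ofReal, h0 b, Complex.ofReal_zero]
  rw [hz]
  congr 1
  have hκτ' : (κ : ℂ) * τ = c := by exact_mod_cast hκτ
  have hI := Complex.I_sq
  push_cast
  rw [← hκτ']
  linear_combination (-(τ : ℂ) * κ ^ 2 / 2) * hI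

end GaussianLimit

/-! ### Wiener measure and Cameron–Martin paths -/

section CameronMartinPath

variable {m : ℕ}

/-- The derivative of the path `s ↦ min s t` in the direction of the `i`-th coordinate. It represents
the evaluation of the `i`-th component at time `t` on the Cameron–Martin space. -/
noncomputable def cmIndicator (t : I) (i : Fin m) : CameronMartin m :=
  indicatorConstLp 2 (s := Set.Iic t) measurableSet_Iic (measure_ne_top _ _)
    (EuclideanSpace.single i (1 : ℝ))

theorem cmPath_apply_eq_inner (h : CameronMartin m) (t : I) (i : Fin m) :
    cmPath h t i = inner ℝ (cmIndicator t i) h := by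
  rw [cmIndicator, L2.inner_indicatorConstLp_eq_inner_setIntegral, EuclideanSpace.inner_single_left]
  simp [cmPath]

theorem cmPath_smul (r : ℝ) (h : CameronMartin m) : cmPath (r • h) = r • cmPath h := by
  ext t i
  simp [cmPath_apply_eq_inner, inner_smul_right]

theorem cmPath_cmIndicator_apply (s t : I) (i j : Fin m) :
    cmPath (cmIndicator t i) s j = if i = j then min (s : ℝ) (t : ℝ) else 0 := by
  rw [cmPath_apply_eq_inner, cmIndicator, cmIndicator,
    L2.inner_indicatorConstLp_indicatorConstLp, Set.Iic_inter_Iic, EuclideanSpace.inner_single_left,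
    measureReal_def, unitInterval.volume_Iic]
  have h0 : (0 : ℝ) ≤ min (s : ℝ) (t : ℝ) := le_min s.2.1 t.2.1
  by_cases hij : i = j
  · subst hij
    rw [← ENNReal.toReal_ofReal h0, ENNReal.ofReal_min]
    simp
  · simp [hij, Ne.symm hij]

/-- Evaluation of the `i`-th component of a path at time `t`. -/
noncomputable def pathEval (t : I) (i : Fin m) : StrongDual ℝ (PathSpace m) :=
  (EuclideanSpace.proj i : EuclideanSpace ℝ (Fin m) →L[ℝ] ℝ).comp
    (ContinuousMap.evalCLM ℝ t)

@[simp]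
theorem pathEval_apply (t : I) (i : Fin m) (ω : PathSpace m) : pathEval t i ω = ω t i := rfl

end CameronMartinPath

namespace IsWienerMeasure

variable {m : ℕ} {μ : Measure (PathSpace m)}

theorem integral_strongDual (hμ : IsWienerMeasure μ) (b : StrongDual ℝ (PathSpace m)) :
    ∫ ω, b ω ∂μ = 0 := by
  have := hμ.gaussian
  have h1 : ∫ ω, ω ∂μ = 0 := by
    ext t i
    have h2 := IsGaussian.integral_dual (μ := μ) (pathEval t i)
    rw [pathEval_apply] at h2
    rw [← h2]
    exact hμ.mean t i
  rw [IsGaussian.integral_dual, h1, map_zero]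

/-- Covariances with a continuous linear functional are read off from a Bochner integral. -/
theorem covariance_eq_apply_integral_smul (hμ : IsWienerMeasure μ) {g : PathSpace m → ℝ}
    (hg : MemLp g 2 μ) (b : StrongDual ℝ (PathSpace m)) :
    cov[fun ω => b ω, g; μ] = b (∫ ω, g ω • ω ∂μ) := by
  have := hμ.gaussian
  have hi : Integrable (fun ω => g ω • ω) μ :=
    memLp_one_iff_integrable.1 ((IsGaussian.memLp_two_id (μ := μ)).smul hg)
  rw [covariance_eq_sub (hasGaussianLaw_strongDual b).memLp_two hg, hμ.integral_strongDual b,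
    zero_mul, sub_zero, ← b.integral_comp_comm hi]
  refine integral_congr_ae (Eventually.of_forall fun ω => ?_)
  simp [mul_comm]

theorem covariance_pathEval (hμ : IsWienerMeasure μ) (b : StrongDual ℝ (PathSpace m)) (t : I)
    (i : Fin m) : cov[fun ω => b ω, fun ω => ω t i; μ] = b (cmPath (cmIndicator t i)) := by
  have := hμ.gaussian
  have hm : ∀ (t : I) (i : Fin m), MemLp (fun ω : PathSpace m => ω t i) 2 μ := fun t i =>
    (hasGaussianLaw_strongDual (pathEval t i)).memLp_two
  rw [hμ.covariance_eq_apply_integral_smul (hm t i)]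
  congr 1
  ext s j
  have h1 := hμ.covariance_eq_apply_integral_smul (hm t i) (pathEval s j)
  rw [pathEval_apply, covariance_eq_sub (hasGaussianLaw_strongDual (pathEval s j)).memLp_two
    (hm t i)] at h1
  rw [← h1, cmPath_cmIndicator_apply]
  have h2 := hμ.cov s t j i
  have h3 := hμ.mean t i
  simp only [Pi.mul_apply, pathEval_apply, h2, h3, mul_zero, sub_zero, eq_comm]

variable {A : ℕ → PathSpace m →L[ℝ] CameronMartin m} {l : CameronMartin m} {g : PathSpace m → ℝ}

/-- If `⟨l, A n ω⟩` converges almost surely to `g`, where the `A n` approximate the identity on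
Cameron–Martin paths, then `g` is the Wiener integral of `l`: its covariances are given by the
Cameron–Martin path of `l`. -/
theorem covariance_eq_apply_cmPath (hμ : IsWienerMeasure μ)
    (hA : ∀ h : CameronMartin m, Tendsto (fun n => A n (cmPath h)) atTop (𝓝 h))
    (hg : ∀ᵐ ω ∂μ, Tendsto (fun n => inner ℝ l (A n ω)) atTop (𝓝 (g ω)))
    (b : StrongDual ℝ (PathSpace m)) : cov[fun ω => b ω, g; μ] = b (cmPath l) := by
  have := hμ.gaussian
  have hlim : ∀ᵐ ω ∂μ, Tendsto (fun n => ((innerSL ℝ l).comp (A n)) ω) atTop (𝓝 (g ω)) := hg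
  have hg2 := (hasGaussianLaw_of_tendsto hμ.integral_strongDual hlim).memLp_two
  rw [hμ.covariance_eq_apply_integral_smul hg2]
  congr 1
  ext t i
  have h1 := hμ.covariance_eq_apply_integral_smul hg2 (pathEval t i)
  rw [pathEval_apply] at h1
  rw [← h1]
  refine tendsto_nhds_unique
    (covariance_tendsto hμ.integral_strongDual hlim (pathEval t i)) ?_
  rw [cmPath_apply_eq_inner, real_inner_comm]
  refine ((tendsto_const_nhds (x := l)).inner (hA (cmIndicator t i))).congr fun n => ?_
  rw [covariance_comm]
  exact (hμ.covariance_pathEval ((innerSL ℝ l).comp (A n)) t i).symm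

theorem variance_eq_norm_sq (hμ : IsWienerMeasure μ)
    (hA : ∀ h : CameronMartin m, Tendsto (fun n => A n (cmPath h)) atTop (𝓝 h))
    (hg : ∀ᵐ ω ∂μ, Tendsto (fun n => inner ℝ l (A n ω)) atTop (𝓝 (g ω))) :
    Var[g; μ] = ‖l‖ ^ 2 := by
  have := hμ.gaussian
  have hlim : ∀ᵐ ω ∂μ, Tendsto (fun n => ((innerSL ℝ l).comp (A n)) ω) atTop (𝓝 (g ω)) := hg
  refine tendsto_nhds_unique
    (covariance_limit_tendsto_variance hμ.integral_strongDual hlim) ?_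
  rw [← real_inner_self_eq_norm_sq]
  refine ((tendsto_const_nhds (x := l)).inner (hA l)).congr fun n => ?_
  exact (hμ.covariance_eq_apply_cmPath hA hg ((innerSL ℝ l).comp (A n))).symm

theorem map_eq_gaussianReal (hμ : IsWienerMeasure μ)
    (hg : ∀ᵐ ω ∂μ, Tendsto (fun n => inner ℝ l (A n ω)) atTop (𝓝 (g ω))) :
    μ.map g = gaussianReal 0 (Var[g; μ]).toNNReal := by
  have := hμ.gaussian
  exact (map_eq_gaussianReal_of_tendsto_ae
    (fun n => hasGaussianLaw_strongDual ((innerSL ℝ l).comp (A n)))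
    (fun n => hμ.integral_strongDual _) hg).1

theorem map_add_cmPath (hμ : IsWienerMeasure μ)
    (hA : ∀ h : CameronMartin m, Tendsto (fun n => A n (cmPath h)) atTop (𝓝 h))
    (hg : ∀ᵐ ω ∂μ, Tendsto (fun n => inner ℝ l (A n ω)) atTop (𝓝 (g ω))) :
    μ.map (fun ω => ω + cmPath l)
      = μ.withDensity fun ω => ENNReal.ofReal (Real.exp (g ω - ‖l‖ ^ 2 / 2)) := by
  have := hμ.gaussian
  have hlim : ∀ᵐ ω ∂μ, Tendsto (fun n => ((innerSL ℝ l).comp (A n)) ω) atTop (𝓝 (g ω)) := hg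
  rw [← hμ.variance_eq_norm_sq hA hg]
  exact map_add_eq_withDensity hμ.integral_strongDual hlim
    (hμ.covariance_eq_apply_cmPath hA hg)

end IsWienerMeasure

/-! ### Dilations, lifts and translations of models -/

theorem NoiseSymbol.canonical_zero {m : ℕ} (τ : NoiseSymbol m) (s : I) :
    (∀ᵐ t : I, τ.canonical (0 : CameronMartin m) s t = 0) ∧
      (τ.IsFunction → ∀ t, τ.canonical (0 : CameronMartin m) s t = 0) := by
  induction τ with
  | xi j =>
    exact ⟨Eventually.of_forall fun t => by simp [NoiseSymbol.canonical], fun h => h.elim⟩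
  | integ H τ ih =>
    have h : ∀ t, (NoiseSymbol.integ H τ).canonical (0 : CameronMartin m) s t = 0 := by
      intro t
      have h0 : ∀ r : I, ∫ u in Set.Iio r, volterraKernel H u r * τ.canonical 0 s u = 0 := by
        intro r
        refine integral_eq_zero_of_ae ?_
        filter_upwards [ae_restrict_of_ae ih.1] with u hu
        simp [hu]
      simp [NoiseSymbol.canonical, h0]
    exact ⟨Eventually.of_forall h, fun _ => h⟩
  | mul τ υ ih₁ ih₂ =>
    refine ⟨?_, fun h t => ?_⟩
    · filter_upwards [ih₁.1] with t ht
      simp [NoiseSymbol.canonical, ht]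
    · simp [NoiseSymbol.canonical, ih₁.2 h.1 t]

namespace ModelSpace

variable {m : ℕ} {S : SymbolSet m} (𝓜 : ModelSpace S)

theorem dil_lift_zero (r : ℝ) : 𝓜.dil r (𝓜.lift 0) = 𝓜.lift 0 := by
  have hcomp : (𝓜.dil r (𝓜.lift 0)).1.comp = (𝓜.lift 0).1.comp := by
    funext τ p
    have h0 : (𝓜.lift 0).1.comp τ p = 0 := by
      rw [𝓜.lift_comp]
      exact (τ.1.canonical_zero p.1.1).2 (S.isFunction τ.1 τ.2) p.1.2
    change r ^ τ.1.deg * (𝓜.lift 0).1.comp τ p = _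
    rw [h0, mul_zero]
  exact Subtype.ext (Model.ext (Model.path_eq_of_comp_eq hcomp) hcomp)

theorem trans_lift_zero (k : CameronMartin m) : 𝓜.trans k (𝓜.lift 0) = 𝓜.lift k := by
  rw [𝓜.trans_lift, zero_add]

theorem dil_trans' (r : ℝ) (h : CameronMartin m) (M : 𝓜.Pt) :
    𝓜.dil r (𝓜.trans h M) = 𝓜.trans (r • h) (𝓜.dil r M) :=
  Subtype.ext (𝓜.dil_trans r h M)

theorem dil_lift (r : ℝ) (k : CameronMartin m) : 𝓜.dil r (𝓜.lift k) = 𝓜.lift (r • k) := by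
  rw [← trans_lift_zero, dil_trans', dil_lift_zero, trans_lift_zero]

theorem continuous_lift : Continuous 𝓜.lift := by
  have h : 𝓜.lift = fun k => 𝓜.trans k (𝓜.lift 0) := funext fun k => (𝓜.trans_lift_zero k).symm
  rw [h]
  exact 𝓜.continuous_trans.comp (by fun_prop : Continuous fun k : CameronMartin m =>
    (k, 𝓜.lift 0))

theorem trans_dil_lift (h k : CameronMartin m) (r : ℝ) :
    𝓜.trans h (𝓜.dil r (𝓜.lift k)) = 𝓜.lift (h + r • k) := by
  rw [dil_lift, 𝓜.trans_lift, add_comm]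

theorem continuous_dil (r : ℝ) : Continuous (𝓜.dil r) := by
  have hS : ∀ (b c : ℝ) (f : TimePair → ℝ),
      holderSize b (fun p => c * f p) = |c| * holderSize b f := by
    intro b c f
    simp only [holderSize, abs_mul, mul_div_assoc]
    exact (Real.mul_iSup_of_nonneg (abs_nonneg c) _).symm
  refine (LipschitzWith.of_dist_le'
    (K := ∑ τ : S.symbols, |r ^ τ.1.deg|) fun M N => ?_).continuous
  change ∑ τ : S.symbols, holderSize (τ.1.hom S.kappa)
      (fun p => r ^ τ.1.deg * M.1.comp τ p - r ^ τ.1.deg * N.1.comp τ p)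
    ≤ _ * ∑ τ : S.symbols, holderSize (τ.1.hom S.kappa) (fun p => M.1.comp τ p - N.1.comp τ p)
  rw [Finset.mul_sum]
  refine Finset.sum_le_sum fun τ _ => ?_
  simp_rw [← mul_sub]
  rw [hS]
  refine mul_le_mul_of_nonneg_right ?_ (Model.holderSize_nonneg _ _)
  exact Finset.single_le_sum (f := fun τ : S.symbols => |r ^ τ.1.deg|)
    (fun τ _ => abs_nonneg _) (Finset.mem_univ τ)

variable {𝓜}

theorem schilderRate_lift_le (h : CameronMartin m) :
    schilderRate 𝓜 (𝓜.lift h) ≤ ENNReal.ofReal (‖h‖ ^ 2 / 2) :=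
  iInf₂_le (f := fun k (_ : 𝓜.lift k = 𝓜.lift h) => ENNReal.ofReal (‖k‖ ^ 2 / 2)) h rfl

theorem exists_lift_of_schilderRate_lt {M : 𝓜.Pt} {c : ℝ≥0∞} (hM : schilderRate 𝓜 M < c) :
    ∃ h, 𝓜.lift h = M ∧ ENNReal.ofReal (‖h‖ ^ 2 / 2) < c := by
  simpa [schilderRate, iInf_lt_iff] using hM

end ModelSpace

section ContinuousLinear

variable {m : ℕ} {S : SymbolSet m} {𝓜 : ModelSpace S} {G : 𝓜.Pt → ℝ}

theorem IsContinuousLinear.congr_path (hG : IsContinuousLinear 𝓜 G) {M N : 𝓜.Pt}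
    (h : M.1.path = N.1.path) : G M = G N := by
  obtain ⟨L, -, hL⟩ := hG
  rw [hL, hL]
  congr 1
  exact Subtype.ext h

theorem IsContinuousLinear.trans (hG : IsContinuousLinear 𝓜 G) (k : CameronMartin m) (M : 𝓜.Pt) :
    G (𝓜.trans k M) = G M + G (𝓜.lift k) := by
  obtain ⟨L, -, hL⟩ := hG
  rw [hL, hL, hL, ← map_add]
  congr 1
  refine Subtype.ext ?_
  change (𝓜.trans k M).1.path = M.1.path + (𝓜.lift k).1.path
  rw [𝓜.trans_path, 𝓜.lift_path]

theorem IsContinuousLinear.lift_smul (hG : IsContinuousLinear 𝓜 G) (r : ℝ) (k : CameronMartin m) :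
    G (𝓜.lift (r • k)) = r * G (𝓜.lift k) := by
  obtain ⟨L, -, hL⟩ := hG
  rw [hL, hL, ← smul_eq_mul, ← map_smul]
  congr 1
  refine Subtype.ext ?_
  change (𝓜.lift (r • k)).1.path = r • (𝓜.lift k).1.path
  rw [𝓜.lift_path, 𝓜.lift_path, cmPath_smul]

end ContinuousLinear

/-! ### The contraction principle -/

section Contraction

variable {Ω E : Type} [MeasurableSpace Ω] [TopologicalSpace E] {μ : Measure Ω}
  {Y : ℝ → Ω → E} {Z : ℝ → Ω → ℝ} {v : ℝ → ℝ} {J : E → ℝ≥0∞} {Λ : ℝ → ℝ≥0∞} {f : ℝ → E → ℝ}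

/-- If an event of `Y` is eventually contained in an event of `Z`, then the lower large deviation
bound of the first is at most the upper bound of the second. -/
theorem iInf_le_iInf_of_eventually_measure_le {E' : Type} [TopologicalSpace E'] {Z : ℝ → Ω → E'}
    {J' : E' → ℝ≥0∞} (hv : ∀ ε, 0 ≤ v ε) (hY : SatisfiesLDP μ Y v J)
    (hZ : SatisfiesLDP μ Z v J') {U : Set E} (hU : IsOpen U) {F : Set E'} (hF : IsClosed F)
    (h : ∀ᶠ ε in 𝓝[>] (0 : ℝ), μ {ω | Y ε ω ∈ U} ≤ μ {ω | Z ε ω ∈ F}) :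
    ⨅ z ∈ F, J' z ≤ ⨅ y ∈ U, J y := by
  have h1 : liminf (fun ε => ((v ε : ℝ) : EReal) * ENNReal.log (μ {ω | Y ε ω ∈ U})) (𝓝[>] (0 : ℝ))
      ≤ limsup (fun ε => ((v ε : ℝ) : EReal) * ENNReal.log (μ {ω | Z ε ω ∈ F})) (𝓝[>] (0 : ℝ)) := by
    refine (liminf_le_liminf ?_).trans liminf_le_limsup
    filter_upwards [h] with ε hε
    exact mul_le_mul_of_nonneg_left (ENNReal.log_monotone hε) (by exact_mod_cast hv ε)
  have h2 := ((hY.lower U hU).trans h1).trans (hZ.upper F hF)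
  exact_mod_cast EReal.neg_le_neg_iff.1 h2

theorem rate_comp_le (hv : ∀ ε, 0 ≤ v ε) (hY : SatisfiesLDP μ Y v J) (hZ : SatisfiesLDP μ Z v Λ)
    (hf : ContinuousOn (fun q : ℝ × E => f q.1 q.2) (Set.Icc 0 1 ×ˢ Set.univ))
    (hrep : ∀ ε ∈ Set.Ioc (0 : ℝ) 1, ∀ᵐ ω ∂μ, Z ε ω = f ε (Y ε ω)) (M : E) :
    Λ (f 0 M) ≤ J M := by
  by_contra! hlt
  obtain ⟨c, hc1, hc2⟩ := exists_between hlt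
  obtain ⟨F, hF, hFc, hFΛ⟩ := exists_mem_nhds_isClosed_subset
    (hZ.lsc (f 0 M) c hc2)
  have hcont : ContinuousWithinAt (fun q : ℝ × E => f q.1 q.2) (Set.Icc 0 1 ×ˢ Set.univ) (0, M) :=
    hf (0, M) ⟨⟨le_rfl, zero_le_one⟩, mem_univ _⟩
  have hev := hcont hF
  rw [nhdsWithin_prod_eq, nhdsWithin_univ] at hev
  obtain ⟨A, hA, U, hU, hAU⟩ := mem_prod_iff.1 (mem_map.1 hev)
  obtain ⟨U', hU'U, hU'o, hMU'⟩ := mem_nhds_iff.1 hU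
  have hA' : A ∈ 𝓝[>] (0 : ℝ) :=
    nhdsWithin_le_of_mem (Icc_mem_nhdsGT zero_lt_one) hA
  have hle : ⨅ z ∈ F, Λ z ≤ ⨅ y ∈ U', J y := by
    refine iInf_le_iInf_of_eventually_measure_le hv hY hZ hU'o hFc ?_
    filter_upwards [hA', Ioc_mem_nhdsGT zero_lt_one] with ε hεA hε
    refine measure_mono_ae ?_
    filter_upwards [hrep ε hε] with ω hω hωU
    change Z ε ω ∈ F
    rw [hω]
    exact hAU (show (ε, Y ε ω) ∈ A ×ˢ U from ⟨hεA, hU'U hωU⟩)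
  have h1 : c ≤ ⨅ z ∈ F, Λ z := le_iInf₂ fun z hz => (hFΛ hz).le
  have h2 : ⨅ y ∈ U', J y ≤ J M := iInf₂_le M hMU'
  exact absurd hc1 (not_lt.2 ((h1.trans hle).trans h2))

theorem exists_rate_lt_of_rate_lt (hv : ∀ ε, 0 ≤ v ε) (hY : SatisfiesLDP μ Y v J)
    (hZ : SatisfiesLDP μ Z v Λ) (hgood : ∀ c : ℝ≥0, IsCompact {y | J y ≤ c})
    (hf : ContinuousOn (fun q : ℝ × E => f q.1 q.2) (Set.Icc 0 1 ×ˢ Set.univ))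
    (hrep : ∀ ε ∈ Set.Ioc (0 : ℝ) 1, ∀ᵐ ω ∂μ, Z ε ω = f ε (Y ε ω)) {z : ℝ} {c : ℝ≥0∞}
    (hz : Λ z < c) : ∃ M, f 0 M = z ∧ J M < c := by
  by_contra! hno
  obtain ⟨c', hc1, hc2⟩ := ENNReal.lt_iff_exists_nnreal_btwn.1 hz
  have hK := hgood c'
  have hloc : ∀ M ∈ {y | J y ≤ c'}, {q : (ℝ × ℝ) × E | f q.1.1 q.2 ≠ q.1.2}
      ∈ (𝓝[Set.Icc 0 1] (0 : ℝ) ×ˢ 𝓝 z) ×ˢ 𝓝 M := by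
    intro M hM
    have hne : f 0 M ≠ z := fun h =>
      absurd (hno M h) (not_le.2 (lt_of_le_of_lt hM hc2))
    have hcont : Tendsto (fun q : ℝ × E => f q.1 q.2) (𝓝[Set.Icc 0 1] (0 : ℝ) ×ˢ 𝓝 M)
        (𝓝 (f 0 M)) := by
      have := hf (0, M) ⟨⟨le_rfl, zero_le_one⟩, mem_univ _⟩
      rwa [ContinuousWithinAt, nhdsWithin_prod_eq, nhdsWithin_univ] at this
    have h1 : Tendsto (fun q : (ℝ × ℝ) × E => f q.1.1 q.2)
        ((𝓝[Set.Icc 0 1] (0 : ℝ) ×ˢ 𝓝 z) ×ˢ 𝓝 M) (𝓝 (f 0 M)) :=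
      hcont.comp ((tendsto_fst.comp tendsto_fst).prodMk tendsto_snd)
    have h2 : Tendsto (fun q : (ℝ × ℝ) × E => q.1.2)
        ((𝓝[Set.Icc 0 1] (0 : ℝ) ×ˢ 𝓝 z) ×ˢ 𝓝 M) (𝓝 z) := tendsto_snd.comp tendsto_fst
    exact ((h1.sub h2).eventually_ne (sub_ne_zero.2 hne)).mono fun q hq => sub_ne_zero.1 hq
  have hunif := hK.mem_prod_nhdsSet_of_forall hloc
  obtain ⟨A, hA, U, hU, hAU⟩ := mem_prod_iff.1 hunif
  obtain ⟨A', hA', B, hB, hAB⟩ := mem_prod_iff.1 hA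
  obtain ⟨B', hB'B, hB'o, hzB'⟩ := mem_nhds_iff.1 hB
  obtain ⟨U', hU'o, hKU', hU'U⟩ := mem_nhdsSet_iff_exists.1 hU
  have hA'' : A' ∈ 𝓝[>] (0 : ℝ) := nhdsWithin_le_of_mem (Icc_mem_nhdsGT zero_lt_one) hA'
  have hle : ⨅ y ∈ U'ᶜ, J y ≤ ⨅ w ∈ B', Λ w := by
    refine iInf_le_iInf_of_eventually_measure_le hv hZ hY hB'o hU'o.isClosed_compl ?_
    filter_upwards [hA'', Ioc_mem_nhdsGT zero_lt_one] with ε hεA hε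
    refine measure_mono_ae ?_
    filter_upwards [hrep ε hε] with ω hω hωB hωU
    exact hAU (show ((ε, Z ε ω), Y ε ω) ∈ A ×ˢ U from
      ⟨hAB ⟨hεA, hB'B hωB⟩, hU'U hωU⟩) hω.symm
  have h1 : (c' : ℝ≥0∞) ≤ ⨅ y ∈ U'ᶜ, J y := le_iInf₂ fun y hy =>
    (not_le.1 fun h => hy (hKU' h)).le
  exact absurd hc1 (not_lt.2 ((h1.trans hle).trans (iInf₂_le z hzB')))

end Contraction

/-! ### Minimal energy and its derivative -/

/-- `c` is the derivative of `φ` at `h₀` in the direction `v`, strictly in the base point: the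
difference quotients at base points `h` near `h₀` are close to `c`. -/
def HasStrictDirDerivAt {H : Type*} [NormedAddCommGroup H] [NormedSpace ℝ H] (φ : H → ℝ) (h₀ v : H)
    (c : ℝ) : Prop :=
  ∀ ε > 0, ∃ δ > 0, ∀ h, ‖h - h₀‖ < δ → ∀ s : ℝ, |s| < δ →
    |φ (h + s • v) - φ h - s * c| ≤ ε * |s|

section Energy

variable {H : Type*} [NormedAddCommGroup H] [InnerProductSpace ℝ H] {φ : H → ℝ} {h₀ v : H}

theorem HasStrictDirDerivAt.hasDerivAt {c : ℝ} (hd : HasStrictDirDerivAt φ h₀ v c) :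
    HasDerivAt (fun s : ℝ => φ (h₀ + s • v)) c 0 := by
  rw [hasDerivAt_iff_isLittleO, Asymptotics.isLittleO_iff]
  intro ε hε
  obtain ⟨δ, hδ, h⟩ := hd ε hε
  filter_upwards [Metric.ball_mem_nhds (0 : ℝ) hδ] with s hs
  have := h h₀ (by simpa using hδ) s (by simpa using hs)
  simpa using this

/-- Along a direction with unit derivative, the level `y` is reached from every nearby point `h` by
a step that is `y - φ h` to first order, by the intermediate value theorem. -/
theorem HasStrictDirDerivAt.exists_step (hd : HasStrictDirDerivAt φ h₀ v 1) (hφ : Continuous φ)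
    {ε : ℝ} (hε : 0 < ε) (hε1 : ε ≤ 1) :
    ∃ δ > 0, ∀ h y, ‖h - h₀‖ < δ → |y - φ h| < δ →
      ∃ s : ℝ, |s - (y - φ h)| ≤ ε * |y - φ h| ∧ φ (h + s • v) = y := by
  obtain ⟨δ, hδ, hest⟩ := hd (ε / 2) (by positivity)
  refine ⟨δ / 2, by positivity, fun h y hh hy => ?_⟩
  set t := y - φ h with ht
  have hT : 0 ≤ |t| := abs_nonneg t
  have hbound : ∀ s : ℝ, |s| ≤ 2 * |t| → |φ (h + s • v) - φ h - s| ≤ ε / 2 * |s| := by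
    intro s hs
    have := hest h (by linarith) s (by linarith)
    rwa [mul_one] at this
  have hup : y ≤ φ (h + (2 * |t|) • v) := by
    have h1 := hbound (2 * |t|) (by rw [abs_of_nonneg (by positivity)])
    rw [abs_of_nonneg (by positivity : (0 : ℝ) ≤ 2 * |t|)] at h1
    have h2 := (abs_le.1 h1).1
    nlinarith [le_abs_self t]
  have hlo : φ (h + (-(2 * |t|)) • v) ≤ y := by
    have h1 := hbound (-(2 * |t|)) (by rw [abs_neg, abs_of_nonneg (by positivity)])
    rw [abs_neg, abs_of_nonneg (by positivity : (0 : ℝ) ≤ 2 * |t|)] at h1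
    have h2 := (abs_le.1 h1).2
    nlinarith [neg_abs_le t]
  have hc : ContinuousOn (fun s : ℝ => φ (h + s • v)) (Set.Icc (-(2 * |t|)) (2 * |t|)) :=
    (hφ.comp (by fun_prop)).continuousOn
  obtain ⟨s, hs, hsy⟩ := intermediate_value_Icc (by linarith) hc ⟨hlo, hup⟩
  have hsa : |s| ≤ 2 * |t| := abs_le.2 hs
  refine ⟨s, ?_, hsy⟩
  have h1 := hbound s hsa
  have hsy' : φ (h + s • v) = y := hsy
  rw [hsy', ← ht, abs_sub_comm] at h1
  nlinarith

theorem norm_add_smul_sq (h w : H) (s : ℝ) :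
    ‖h + s • w‖ ^ 2 / 2 = ‖h‖ ^ 2 / 2 + s * inner ℝ h w + s ^ 2 * ‖w‖ ^ 2 / 2 := by
  rw [norm_add_sq_real, inner_smul_right, norm_smul, mul_pow, Real.norm_eq_abs, sq_abs]
  ring

/-- Lagrange's condition: the energy of a minimizer is stationary along the kernel of the
derivative of the constraint. -/
theorem inner_eq_zero_of_minimizer (hd : HasStrictDirDerivAt φ h₀ v 1) (hφ : Continuous φ)
    (hmin : ∀ h, φ h = φ h₀ → ‖h₀‖ ≤ ‖h‖) {k : H} (hk : HasStrictDirDerivAt φ h₀ k 0)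
    (hk' : HasStrictDirDerivAt φ h₀ (-k) 0) : inner ℝ h₀ k = 0 := by
  have key : ∀ k : H, HasStrictDirDerivAt φ h₀ k 0 → 0 ≤ inner ℝ h₀ k := by
    intro k hk
    by_contra! hneg
    set q : ℝ := inner ℝ h₀ v with hq
    set p : ℝ := inner ℝ h₀ k with hp
    obtain ⟨δ₁, hδ₁, hstep⟩ := hd.exists_step hφ (ε := 1) one_pos le_rfl
    set ε : ℝ := min 1 (-p / (8 * (|q| + 1))) with hε
    have hε0 : 0 < ε := lt_min one_pos (div_pos (by linarith) (by positivity))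
    have hεq : ε * (8 * (|q| + 1)) ≤ -p := by
      rw [← le_div_iff₀ (by positivity)]; exact min_le_right _ _
    obtain ⟨δ₂, hδ₂, hest⟩ := hk ε hε0
    -- A step of length `r` along `k`, corrected along `v` by `s = O (ε r)`.
    obtain ⟨r, hr0, hr1, hr2, hr3, hr4⟩ : ∃ r : ℝ, 0 < r ∧ r < δ₁ ∧ r < δ₂ ∧ r * ‖k‖ < δ₁ ∧
        r * (‖k‖ + 2 * ‖v‖) ^ 2 < -p / 2 := by
      have h1 : ∀ a b : ℝ, 0 < b → ∀ᶠ r in 𝓝[>] (0 : ℝ), r * a < b := by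
        intro a b hb
        have : Tendsto (fun r : ℝ => r * a) (𝓝[>] 0) (𝓝 0) :=
          tendsto_nhdsWithin_of_tendsto_nhds (by simpa using (tendsto_id (x := 𝓝 (0 : ℝ))).mul_const a)
        exact this.eventually_lt_const hb
      obtain ⟨r, h⟩ := (((h1 1 δ₁ hδ₁).and (h1 1 δ₂ hδ₂)).and ((h1 ‖k‖ δ₁ hδ₁).and
        ((h1 ((‖k‖ + 2 * ‖v‖) ^ 2) (-p / 2) (by linarith)).and self_mem_nhdsWithin))).exists
      exact ⟨r, h.2.2.2, by simpa using h.1.1, by simpa using h.1.2, h.2.1, h.2.2.1⟩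
    have hφr : |φ (h₀ + r • k) - φ h₀| ≤ ε * r := by
      have := hest h₀ (by simpa using hδ₂) r (by rwa [abs_of_pos hr0])
      simpa [abs_of_pos hr0] using this
    have hεr : ε * r ≤ r := by nlinarith [min_le_left 1 (-p / (8 * (|q| + 1)))]
    obtain ⟨s, hs, hφs⟩ := hstep (h₀ + r • k) (φ h₀)
      (by rw [add_sub_cancel_left, norm_smul, Real.norm_eq_abs, abs_of_pos hr0]; exact hr3)
      (by rw [abs_sub_comm]; linarith)
    have hsabs : |s| ≤ 2 * (ε * r) := by
      rw [abs_sub_comm] at hφr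
      have h3 : |s| ≤ |s - (φ h₀ - φ (h₀ + r • k))| + |φ h₀ - φ (h₀ + r • k)| := by
        simpa using abs_add_le (s - (φ h₀ - φ (h₀ + r • k))) (φ h₀ - φ (h₀ + r • k))
      linarith
    have hle := hmin _ hφs
    have hexp := norm_add_sq_real h₀ (r • k + s • v)
    rw [← add_assoc, inner_add_right, inner_smul_right, inner_smul_right, ← hp, ← hq] at hexp
    have hnorm : ‖r • k + s • v‖ ≤ r * (‖k‖ + 2 * ‖v‖) := by
      refine (norm_add_le _ _).trans ?_
      rw [norm_smul, norm_smul, Real.norm_eq_abs, Real.norm_eq_abs, abs_of_pos hr0]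
      nlinarith [norm_nonneg v]
    have hsq : ‖r • k + s • v‖ ^ 2 ≤ r * (-p / 2) := by
      have h1 : ‖r • k + s • v‖ ^ 2 ≤ (r * (‖k‖ + 2 * ‖v‖)) ^ 2 :=
        pow_le_pow_left₀ (norm_nonneg _) hnorm 2
      nlinarith
    have hle2 : ‖h₀‖ ^ 2 ≤ ‖h₀ + r • k + s • v‖ ^ 2 := pow_le_pow_left₀ (norm_nonneg _) hle 2
    have hsq' : s * q ≤ 2 * (ε * r) * |q| := by
      refine (le_abs_self _).trans ?_
      rw [abs_mul]
      exact mul_le_mul_of_nonneg_right hsabs (abs_nonneg q)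
    have hrε : r * (ε * (8 * (|q| + 1))) ≤ r * (-p) := mul_le_mul_of_nonneg_left hεq hr0.le
    nlinarith [mul_pos hr0 hε0, mul_pos hr0 (neg_pos.2 hneg)]
  refine le_antisymm ?_ (key k hk)
  have := key (-k) hk'
  rw [inner_neg_right] at this
  linarith

/-- The envelope theorem for the minimal energy `Λ` on the level sets of a constraint `φ`: a control
at level `y` near `x` is obtained from the minimizer at `x`, and conversely a control at level `x`
from a near-minimizer at level `y`, by a step along `v`. Both comparisons have the same first
order. -/
theorem hasDerivAt_realRate {Λ : ℝ → ℝ≥0∞} {x : ℝ} (hd : HasStrictDirDerivAt φ h₀ v 1)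
    (hφ : Continuous φ) (hΛ : Continuous Λ) (hx : φ h₀ = x)
    (henergy : Λ x = ENNReal.ofReal (‖h₀‖ ^ 2 / 2))
    (hle : ∀ h, Λ (φ h) ≤ ENNReal.ofReal (‖h‖ ^ 2 / 2))
    (hex : ∀ y c, Λ y < c → ∃ h, φ h = y ∧ ENNReal.ofReal (‖h‖ ^ 2 / 2) < c)
    (hstable : ∀ δ > 0, ∃ η > 0, ∀ h, |φ h - x| < η → ‖h‖ ^ 2 / 2 < ‖h₀‖ ^ 2 / 2 + η →
      ‖h - h₀‖ < δ) :
    HasDerivAt (realRate Λ) (inner ℝ h₀ v) x := by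
  set q : ℝ := inner ℝ h₀ v with hq
  have hfx : realRate Λ x = ‖h₀‖ ^ 2 / 2 := by
    rw [realRate, henergy, ENNReal.toReal_ofReal (by positivity)]
  have hfle : ∀ h, realRate Λ (φ h) ≤ ‖h‖ ^ 2 / 2 := fun h =>
    ENNReal.toReal_le_of_le_ofReal (by positivity) (hle h)
  have hcont : ContinuousAt (realRate Λ) x :=
    (ENNReal.tendsto_toReal (by rw [henergy]; exact ENNReal.ofReal_ne_top)).comp
      hΛ.continuousAt
  rw [hasDerivAt_iff_isLittleO, Asymptotics.isLittleO_iff]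
  intro ε hε
  set ε₁ : ℝ := min 1 (ε / (4 * (|q| + 1))) with hε₁
  have hε₁0 : 0 < ε₁ := lt_min one_pos (by positivity)
  have hε₁q : ε₁ * |q| ≤ ε / 4 := by
    have h1 : ε₁ * (4 * (|q| + 1)) ≤ ε := by
      rw [← le_div_iff₀ (by positivity)]; exact min_le_right _ _
    nlinarith
  obtain ⟨δ, hδ, hstep⟩ := hd.exists_step hφ hε₁0 (min_le_left _ _)
  set δ₁ : ℝ := min δ (ε / (8 * (‖v‖ + 1))) with hδ₁
  have hδ₁0 : 0 < δ₁ := lt_min hδ (by positivity)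
  have hδ₁v : 2 * δ₁ * ‖v‖ ≤ ε / 4 := by
    have h1 : δ₁ * (8 * (‖v‖ + 1)) ≤ ε := by
      rw [← le_div_iff₀ (by positivity)]; exact min_le_right _ _
    nlinarith [norm_nonneg v]
  obtain ⟨η, hη, hη'⟩ := hstable δ₁ hδ₁0
  have hev1 : ∀ᶠ y in 𝓝 x, realRate Λ y < ‖h₀‖ ^ 2 / 2 + η / 2 :=
    hcont.eventually_lt_const (by rw [hfx]; linarith)
  have hev2 : ∀ r > 0, ∀ᶠ y in 𝓝 x, |y - x| < r := fun r hr =>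
    Metric.ball_mem_nhds x hr
  filter_upwards [hev1, hev2 δ hδ, hev2 η hη, hev2 1 one_pos, hev2 (η / 2) (by positivity),
    hev2 (ε / (4 * (1 + 2 * ‖v‖ ^ 2))) (by positivity)] with y hy1 hy2 hy3 hy4 hy5 hy6
  set t := y - x with ht
  have ht0 : 0 ≤ |t| := abs_nonneg t
  have htt : |t| * (1 + 2 * ‖v‖ ^ 2) ≤ ε / 4 := by
    rw [lt_div_iff₀ (by positivity)] at hy6
    linarith
  have hstepabs : ∀ u s : ℝ, |s - u| ≤ ε₁ * |u| →
      |s| ≤ 2 * |u| ∧ s * q ≤ u * q + ε₁ * |q| * |u| := by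
    intro u s hs
    refine ⟨?_, ?_⟩
    · have h1 : |s| ≤ |s - u| + |u| := by simpa using abs_add_le (s - u) u
      nlinarith [min_le_left 1 (ε / (4 * (|q| + 1))), abs_nonneg u]
    · have h1 : (s - u) * q ≤ ε₁ * |u| * |q| := by
        refine (le_abs_self _).trans ?_
        rw [abs_mul]
        exact mul_le_mul_of_nonneg_right hs (abs_nonneg q)
      linarith
  have hquad : ∀ s : ℝ, |s| ≤ 2 * |t| → s ^ 2 * ‖v‖ ^ 2 / 2 ≤ |t| * (|t| * (2 * ‖v‖ ^ 2)) := by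
    intro s hs
    have h1 : s ^ 2 ≤ (2 * |t|) ^ 2 := sq_le_sq' (by linarith [neg_abs_le s]) ((le_abs_self s).trans hs)
    nlinarith [sq_nonneg ‖v‖]
  have hupper : realRate Λ y - realRate Λ x - t * q ≤ ε * |t| := by
    obtain ⟨s, hs, hφs⟩ := hstep h₀ y (by simpa using hδ) (by rw [hx]; exact hy2)
    rw [hx, ← ht] at hs
    obtain ⟨hs1, hs2⟩ := hstepabs t s hs
    have h1 := hfle (h₀ + s • v)
    rw [hφs, norm_add_smul_sq, ← hq] at h1
    have h2 := hquad s hs1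
    rw [hfx]
    nlinarith [mul_le_mul_of_nonneg_left htt ht0, mul_le_mul_of_nonneg_right hε₁q ht0]
  have hlower : -(ε * |t|) ≤ realRate Λ y - realRate Λ x - t * q := by
    rcases eq_or_ne t 0 with h0 | h0
    · have : y = x := by linarith [ht]
      rw [h0, this]
      simp
    have hypos : 0 < t ^ 2 := by positivity
    have hfin : Λ y ≠ ∞ := by
      obtain ⟨s, -, hφs⟩ := hstep h₀ y (by simpa using hδ) (by rw [hx]; exact hy2)
      rw [← hφs]
      exact ne_top_of_le_ne_top ENNReal.ofReal_ne_top (hle _)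
    have hlt : Λ y < ENNReal.ofReal (realRate Λ y + t ^ 2) := by
      have h2 : 0 ≤ realRate Λ y := ENNReal.toReal_nonneg
      refine (ENNReal.ofReal_toReal hfin).symm.trans_lt ?_
      exact (ENNReal.ofReal_lt_ofReal_iff (by linarith)).2 (lt_add_of_pos_right _ hypos)
    obtain ⟨h, hφh, hh⟩ := hex y _ hlt
    have hh' : ‖h‖ ^ 2 / 2 < realRate Λ y + t ^ 2 :=
      (ENNReal.ofReal_lt_ofReal_iff_of_nonneg (by positivity)).1 hh
    have htsq : t ^ 2 ≤ |t| * |t| := by rw [← sq, sq_abs]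
    have hclose := hη' h (by rw [hφh]; exact hy3) (by nlinarith)
    obtain ⟨s, hs, hφs⟩ := hstep h x (hclose.trans_le (min_le_left _ _))
      (by rw [hφh, abs_sub_comm]; exact hy2)
    have hxy : x - φ h = -t := by rw [hφh]; ring
    rw [hxy] at hs
    obtain ⟨hs1, hs2⟩ := hstepabs (-t) s hs
    rw [abs_neg] at hs1 hs2
    have h1 := hfle (h + s • v)
    rw [hφs, norm_add_smul_sq] at h1
    have h2 := hquad s hs1
    have h3 : s * inner ℝ h v ≤ s * q + 2 * |t| * (δ₁ * ‖v‖) := by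
      have h4 : inner ℝ h v = q + inner ℝ (h - h₀) v := by rw [inner_sub_left, hq]; ring
      have h5 : s * inner ℝ (h - h₀) v ≤ 2 * |t| * (δ₁ * ‖v‖) := by
        refine (le_abs_self _).trans ?_
        rw [abs_mul]
        refine mul_le_mul hs1 ((abs_real_inner_le_norm _ _).trans ?_) (abs_nonneg _) (by positivity)
        exact mul_le_mul_of_nonneg_right hclose.le (norm_nonneg v)
      rw [h4]
      linarith
    nlinarith [mul_le_mul_of_nonneg_left htt ht0, mul_le_mul_of_nonneg_right hε₁q ht0,
      mul_le_mul_of_nonneg_right hδ₁v ht0]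
  rw [Real.norm_eq_abs, Real.norm_eq_abs, smul_eq_mul]
  exact abs_le.2 ⟨hlower, hupper⟩

end Energy

/-! ### The control map -/

section ControlMap

variable {m : ℕ} {S : SymbolSet m} {𝓜 : ModelSpace S} {Φ : ℝ → 𝓜.Pt → C(I, ℝ)}

theorem continuousOn_apply_one
    (hΦ : ContinuousOn (fun q : ℝ × 𝓜.Pt => Φ q.1 q.2) (Set.Icc 0 1 ×ˢ Set.univ)) :
    ContinuousOn (fun q : ℝ × 𝓜.Pt => Φ q.1 q.2 1) (Set.Icc 0 1 ×ˢ Set.univ) :=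
  (continuous_eval_const (F := C(I, ℝ)) (1 : I)).comp_continuousOn hΦ

theorem continuous_apply_one
    (hΦ : ContinuousOn (fun q : ℝ × 𝓜.Pt => Φ q.1 q.2) (Set.Icc 0 1 ×ˢ Set.univ)) {ε : ℝ}
    (hε : ε ∈ Set.Icc (0 : ℝ) 1) : Continuous fun M : 𝓜.Pt => Φ ε M 1 :=
  (continuousOn_apply_one hΦ).comp_continuous
    (by fun_prop : Continuous fun M : 𝓜.Pt => (ε, M)) fun M => ⟨hε, mem_univ M⟩

theorem continuous_controlMap
    (hΦ : ContinuousOn (fun q : ℝ × 𝓜.Pt => Φ q.1 q.2) (Set.Icc 0 1 ×ˢ Set.univ)) :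
    Continuous (controlMap 𝓜 Φ) :=
  (continuous_apply_one hΦ ⟨le_rfl, zero_le_one⟩).comp 𝓜.continuous_lift

variable {G₁ G₂ : CameronMartin m → 𝓜.Pt → ℝ} {R : CameronMartin m → ℝ → 𝓜.Pt → ℝ}

theorem TaylorAssumption.hasStrictDirDerivAt (hT : TaylorAssumption 𝓜 Φ G₁ G₂ R)
    (h₀ v : CameronMartin m) :
    HasStrictDirDerivAt (controlMap 𝓜 Φ) h₀ v (G₁ h₀ (𝓜.lift v)) := by
  -- The expansion is one-sided; negative steps are positive steps along `-v`.
  have key : ∀ v : CameronMartin m, ∀ ε > 0, ∃ δ > 0, ∀ h, ‖h - h₀‖ < δ → ∀ s : ℝ, 0 < s → s < δ →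
      |controlMap 𝓜 Φ (h + s • v) - controlMap 𝓜 Φ h - s * G₁ h₀ (𝓜.lift v)| ≤ ε * s := by
    intro v ε hε
    obtain ⟨δ₀, hδ₀, C, ρ, hρ, hR⟩ := hT.remainder (‖h₀‖ + 1)
    set N := (𝓜.lift v).1.homNorm with hN
    set K := |G₂ h₀ (𝓜.lift v)| + 1 with hK
    have hc₁ : Continuous fun h => G₁ h (𝓜.lift v) := hT.continuous_G₁.comp (by fun_prop :
      Continuous fun h : CameronMartin m => (h, 𝓜.lift v))
    have hc₂ : Continuous fun h => G₂ h (𝓜.lift v) := hT.continuous_G₂.comp (by fun_prop :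
      Continuous fun h : CameronMartin m => (h, 𝓜.lift v))
    have hev : ∀ᶠ h in 𝓝 h₀, ‖h‖ < ‖h₀‖ + 1 ∧
        |G₁ h (𝓜.lift v) - G₁ h₀ (𝓜.lift v)| < ε / 2 ∧ |G₂ h (𝓜.lift v)| < K := by
      refine (continuous_norm.continuousAt.eventually_lt_const (by linarith)).and
        (Eventually.and ?_ ?_)
      · exact hc₁.continuousAt.eventually (Metric.ball_mem_nhds _ (by positivity))
      · exact hc₂.abs.continuousAt.eventually_lt_const (lt_add_one _)
    have hsmall : ∀ a b : ℝ, 0 < b → ∀ᶠ r in 𝓝[>] (0 : ℝ), r * a < b := by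
      intro a b hb
      have : Tendsto (fun r : ℝ => r * a) (𝓝[>] 0) (𝓝 0) :=
        tendsto_nhdsWithin_of_tendsto_nhds (by simpa using (tendsto_id (x := 𝓝 (0 : ℝ))).mul_const a)
      exact this.eventually_lt_const hb
    have hevs : ∀ᶠ s in 𝓝[>] (0 : ℝ), s * 1 < 1 ∧ s * N < δ₀ ∧
        s * (K + 1 + |C| * |N| ^ 3) < ε / 2 ∧ ‖ρ s‖ ≤ 1 * ‖s ^ 2‖ :=
      (hsmall _ _ one_pos).and ((hsmall _ _ hδ₀).and ((hsmall _ _ (by positivity)).and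
        (Asymptotics.isLittleO_iff.1 hρ one_pos)))
    obtain ⟨δ₁, hδ₁, h₁⟩ := Metric.eventually_nhds_iff.1 hev
    obtain ⟨δ₂, hδ₂, h₂⟩ := mem_nhdsGT_iff_exists_Ioo_subset.1 hevs
    refine ⟨min δ₁ δ₂, lt_min hδ₁ hδ₂, fun h hh s hs0 hs => ?_⟩
    obtain ⟨hb, hG₁, hG₂⟩ := h₁ (y := h) (by rw [dist_eq_norm]; exact hh.trans_le (min_le_left _ _))
    obtain ⟨hs1, hsN, hsε, hρs⟩ := h₂ ⟨hs0, hs.trans_le (min_le_right _ _)⟩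
    rw [mul_one] at hs1
    have hexp := hT.expansion h s ⟨hs0.le, hs1.le⟩ (𝓜.lift v)
    rw [𝓜.trans_dil_lift] at hexp
    have hrem := hR h hb.le s ⟨hs0, hs1.le⟩ (𝓜.lift v) hsN.le
    rw [← hN] at hrem
    have hρ' : ρ s ≤ s * s := by
      have h3 : |ρ s| ≤ s * s := by
        rw [Real.norm_eq_abs, Real.norm_eq_abs, abs_of_nonneg (sq_nonneg s), one_mul, sq] at hρs
        exact hρs
      exact (le_abs_self _).trans h3
    have hcub : C * (s ^ 3 * N ^ 3) ≤ s * s * (|C| * |N| ^ 3) := by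
      have h3 : C * (s ^ 3 * N ^ 3) ≤ s ^ 3 * (|C| * |N| ^ 3) := by
        refine (le_abs_self _).trans (le_of_eq ?_)
        rw [abs_mul, abs_mul, abs_pow, abs_pow, abs_of_pos hs0]
        ring
      refine h3.trans (mul_le_mul_of_nonneg_right ?_ (by positivity))
      nlinarith [mul_pos hs0 hs0]
    have hquad : |s ^ 2 * G₂ h (𝓜.lift v)| ≤ s * s * K := by
      rw [abs_mul, abs_of_nonneg (sq_nonneg s), sq]
      exact mul_le_mul_of_nonneg_left hG₂.le (by positivity)
    have hlin : |s * (G₁ h (𝓜.lift v) - G₁ h₀ (𝓜.lift v))| ≤ s * (ε / 2) := by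
      rw [abs_mul, abs_of_pos hs0]
      exact mul_le_mul_of_nonneg_left hG₁.le hs0.le
    have hsplit : controlMap 𝓜 Φ (h + s • v) - controlMap 𝓜 Φ h - s * G₁ h₀ (𝓜.lift v)
        = s * (G₁ h (𝓜.lift v) - G₁ h₀ (𝓜.lift v)) + s ^ 2 * G₂ h (𝓜.lift v)
          + R h s (𝓜.lift v) := by
      rw [controlMap, controlMap, hexp]
      ring
    have hsε' : s * (s * (K + 1 + |C| * |N| ^ 3)) ≤ s * (ε / 2) :=
      mul_le_mul_of_nonneg_left hsε.le hs0.le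
    rw [hsplit]
    refine (abs_add_three _ _ _).trans ?_
    linarith
  intro ε hε
  obtain ⟨δ₁, hδ₁, h₁⟩ := key v ε hε
  obtain ⟨δ₂, hδ₂, h₂⟩ := key (-v) ε hε
  refine ⟨min δ₁ δ₂, lt_min hδ₁ hδ₂, fun h hh s hs => ?_⟩
  rcases lt_trichotomy s 0 with h0 | h0 | h0
  · rw [abs_of_neg h0] at hs ⊢
    have := h₂ h (hh.trans_le (min_le_right _ _)) (-s) (by linarith)
      (hs.trans_le (min_le_right _ _))
    have hneg := (hT.linear h₀).lift_smul (-1) v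
    rw [neg_one_smul] at hneg
    rw [smul_neg, neg_smul, neg_neg, hneg] at this
    simpa using this
  · simp [h0]
  · rw [abs_of_pos h0] at hs ⊢
    exact h₁ h (hh.trans_le (min_le_left _ _)) s h0 (hs.trans_le (min_le_left _ _))

theorem TaylorAssumption.fderiv_controlMap (hT : TaylorAssumption 𝓜 Φ G₁ G₂ R)
    {h₀ : CameronMartin m} (hd : DifferentiableAt ℝ (controlMap 𝓜 Φ) h₀) (k : CameronMartin m) :
    fderiv ℝ (controlMap 𝓜 Φ) h₀ k = G₁ h₀ (𝓜.lift k) :=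
  (hd.hasFDerivAt.hasLineDerivAt k).unique (hT.hasStrictDirDerivAt h₀ k).hasDerivAt

end ControlMap

section Minimizer

variable {m : ℕ} {S : SymbolSet m} {𝓜 : ModelSpace S} {Φ : ℝ → 𝓜.Pt → C(I, ℝ)}

/-- Stability of the minimizer: controls whose level and energy are close to those of the unique
minimizer `h₀` are close to `h₀`. Their lifts range in a compact level set of the rate function, so
they accumulate at the lift of `h₀`; since the functional `⟨h₀, ·⟩` is continuous in the model
topology, `⟨h₀, h⟩ → ‖h₀‖²`, which together with the bound on the energy gives norm convergence. -/
theorem norm_sub_lt_of_near_minimizer {φ : CameronMartin m → ℝ} {Ψ G : 𝓜.Pt → ℝ}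
    {h₀ : CameronMartin m} {q : ℝ} (hΨ : Continuous Ψ) (hφ : ∀ h, φ h = Ψ (𝓜.lift h))
    (hG : Continuous G) (hinner : ∀ k, inner ℝ h₀ k = q * G (𝓜.lift k))
    (hlift : Function.Injective 𝓜.lift)
    (hgood : ∀ c : ℝ≥0, IsCompact {M : 𝓜.Pt | schilderRate 𝓜 M ≤ c})
    (hmin : ∀ h, φ h = φ h₀ → h ≠ h₀ → ‖h₀‖ < ‖h‖) {δ : ℝ} (hδ : 0 < δ) :
    ∃ η > 0, ∀ h, |φ h - φ h₀| < η → ‖h‖ ^ 2 / 2 < ‖h₀‖ ^ 2 / 2 + η → ‖h - h₀‖ < δ := by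
  by_contra! hcon
  have hpos : ∀ n : ℕ, (0 : ℝ) < 1 / ((n : ℝ) + 1) := fun n => by positivity
  choose h hφh hen hfar using fun n : ℕ => hcon (1 / ((n : ℝ) + 1)) (hpos n)
  have hzero := tendsto_one_div_add_atTop_nhds_zero_nat (𝕜 := ℝ)
  have hlevel : ∀ c : ℝ≥0, ‖h₀‖ ^ 2 / 2 < c →
      ∀ᶠ n in atTop, 𝓜.lift (h n) ∈ {M : 𝓜.Pt | schilderRate 𝓜 M ≤ c} := by
    intro c hc
    filter_upwards [hzero.eventually_lt_const (sub_pos.2 hc)] with n hn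
    refine (ModelSpace.schilderRate_lift_le _).trans ?_
    rw [← ENNReal.ofReal_coe_nnreal]
    exact ENNReal.ofReal_le_ofReal (by linarith [hen n])
  set c₁ : ℝ≥0 := ⟨‖h₀‖ ^ 2 / 2 + 1, by positivity⟩ with hc₁
  obtain ⟨n₀, hn₀⟩ := eventually_atTop.1 (hlevel c₁ (lt_add_one _))
  obtain ⟨M, hM, ψ, hψ, hψM⟩ := (hgood c₁).tendsto_subseq
    (x := fun n => 𝓜.lift (h (n + n₀))) fun n => hn₀ _ (Nat.le_add_left _ _)
  have hψ' : Tendsto (fun n => ψ n + n₀) atTop atTop :=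
    (tendsto_add_atTop_nat n₀).comp hψ.tendsto_atTop
  have hMrate : schilderRate 𝓜 M ≤ ENNReal.ofReal (‖h₀‖ ^ 2 / 2) := by
    refine le_of_forall_gt fun c hc => ?_
    obtain ⟨c', hc1, hc2⟩ := ENNReal.lt_iff_exists_nnreal_btwn.1 hc
    refine lt_of_le_of_lt ?_ hc2
    have hc' : ‖h₀‖ ^ 2 / 2 < c' := by
      rw [← ENNReal.ofReal_coe_nnreal, ENNReal.ofReal_lt_ofReal_iff_of_nonneg (by positivity)] at hc1
      exact hc1
    exact (hgood c').isClosed.mem_of_tendsto hψM (hψ'.eventually (hlevel c' hc'))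
  have hMφ : Ψ M = φ h₀ := by
    have h1 : Tendsto (fun n => φ (h n)) atTop (𝓝 (φ h₀)) := by
      rw [tendsto_iff_dist_tendsto_zero]
      exact squeeze_zero (fun n => dist_nonneg) (fun n => (hφh n).le) hzero
    refine tendsto_nhds_unique ((hΨ.tendsto M).comp hψM) ((h1.comp hψ').congr fun n => ?_)
    simp [hφ]
  have hMlift : M = 𝓜.lift h₀ := by
    obtain ⟨k, hk, -⟩ := ModelSpace.exists_lift_of_schilderRate_lt
      (hMrate.trans_lt ENNReal.ofReal_lt_top)
    by_contra hne
    have hk₀ : k ≠ h₀ := fun h => hne (by rw [← hk, h])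
    have hlt := hmin k (by rw [hφ, hk, hMφ]) hk₀
    have h1 : schilderRate 𝓜 M < ENNReal.ofReal (‖k‖ ^ 2 / 2) := by
      refine hMrate.trans_lt ?_
      rw [ENNReal.ofReal_lt_ofReal_iff_of_nonneg (by positivity)]
      nlinarith [norm_nonneg h₀]
    obtain ⟨k', hk', hk'lt⟩ := ModelSpace.exists_lift_of_schilderRate_lt h1
    rw [hlift (hk'.trans hk.symm)] at hk'lt
    exact lt_irrefl _ hk'lt
  have hin : Tendsto (fun n => inner ℝ h₀ (h (ψ n + n₀))) atTop (𝓝 (‖h₀‖ ^ 2)) := by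
    rw [← real_inner_self_eq_norm_sq, hinner h₀, ← hMlift]
    refine (((hG.tendsto M).comp hψM).const_mul q).congr fun n => ?_
    simp [hinner]
  have hbd : Tendsto (fun n => 2 * (‖h₀‖ ^ 2 / 2 + 1 / (((ψ n + n₀ : ℕ) : ℝ) + 1))
      - 2 * inner ℝ h₀ (h (ψ n + n₀)) + ‖h₀‖ ^ 2) atTop (𝓝 0) := by
    have h1 := ((((hzero.comp hψ').const_add (‖h₀‖ ^ 2 / 2)).const_mul 2).sub
      (hin.const_mul 2)).add_const (‖h₀‖ ^ 2)
    have h2 : 2 * (‖h₀‖ ^ 2 / 2 + 0) - 2 * ‖h₀‖ ^ 2 + ‖h₀‖ ^ 2 = 0 := by ring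
    rw [h2] at h1
    exact h1
  obtain ⟨n, hn⟩ := (hbd.eventually_lt_const (show (0 : ℝ) < δ ^ 2 by positivity)).exists
  have h1 := norm_sub_sq_real (h (ψ n + n₀)) h₀
  rw [real_inner_comm] at h1
  have h2 := hen (ψ n + n₀)
  have h3 : δ ^ 2 ≤ ‖h (ψ n + n₀) - h₀‖ ^ 2 := pow_le_pow_left₀ hδ.le (hfar _) 2
  linarith

end Minimizer

/-! ### Shifts of the random model -/

/-- Change of variables for a shift with an exponential density. -/
theorem lintegral_eq_lintegral_add {E : Type*} [Add E] [MeasurableSpace E] [MeasurableAdd E]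
    {μ : Measure E} {v : E} {g : E → ℝ} {F : E → ℝ≥0∞} (hg : AEMeasurable g μ)
    (hF : AEMeasurable F μ)
    (hmap : μ.map (fun ω => ω + v) = μ.withDensity fun ω => ENNReal.ofReal (Real.exp (g ω))) :
    ∫⁻ ω, F ω ∂μ = ∫⁻ ω, F (ω + v) * ENNReal.ofReal (Real.exp (-g (ω + v))) ∂μ := by
  have hac : μ.map (fun ω => ω + v) ≪ μ := by
    rw [hmap]; exact withDensity_absolutelyContinuous _ _
  have hm : AEMeasurable (fun ω => F ω * ENNReal.ofReal (Real.exp (-g ω))) μ := by fun_prop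
  rw [← lintegral_map' (f := fun ω => F ω * ENNReal.ofReal (Real.exp (-g ω))) (hm.mono_ac hac)
    (measurable_add_const v).aemeasurable, hmap,
    lintegral_withDensity_eq_lintegral_mul₀ (by fun_prop) hm]
  refine lintegral_congr fun ω => ?_
  rw [Pi.mul_apply, mul_left_comm, ← ENNReal.ofReal_mul (Real.exp_pos _).le, ← Real.exp_add,
    add_neg_cancel, Real.exp_zero, ENNReal.ofReal_one, mul_one]

section Shift

variable {m : ℕ} {S : SymbolSet m} {𝓜 : ModelSpace S} {μ : Measure (PathSpace m)}
  {W : PathSpace m → 𝓜.Pt}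

/-- Almost sure form of the approximation of the random model, along a subsequence. -/
theorem IsWongZakaiLimit.exists_tendsto_ae (hW : IsWongZakaiLimit 𝓜 μ W) :
    ∃ (A : ℕ → PathSpace m →L[ℝ] CameronMartin m) (ren : ℕ → 𝓜.Pt → 𝓜.Pt),
      (∀ h : CameronMartin m, Tendsto (fun n => A n (cmPath h)) atTop (𝓝 h)) ∧
      (∀ n M, (ren n M).1.path = M.1.path) ∧
      (∀ n h M, ren n (𝓜.trans h M) = 𝓜.trans h (ren n M)) ∧
      ∀ᵐ ω ∂μ, Tendsto (fun n => ren n (𝓜.lift (A n ω))) atTop (𝓝 (W ω)) := by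
  obtain ⟨A, ren, -, hA, hpath, hcomm, hlim⟩ := hW
  obtain ⟨ns, hns, hae⟩ := hlim.exists_seq_tendsto_ae
  exact ⟨fun n => A (ns n), fun n => ren (ns n), fun h => (hA h).comp hns.tendsto_atTop,
    fun n => hpath _, fun n => hcomm _, hae⟩

theorem ModelSpace.lift_injective {A : ℕ → PathSpace m →L[ℝ] CameronMartin m}
    (hA : ∀ h : CameronMartin m, Tendsto (fun n => A n (cmPath h)) atTop (𝓝 h)) :
    Function.Injective 𝓜.lift := by
  intro h k hhk
  have hpath : cmPath h = cmPath k := by rw [← 𝓜.lift_path, ← 𝓜.lift_path, hhk]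
  refine tendsto_nhds_unique (hA h) ?_
  rw [hpath]
  exact hA k

/-- The random model of a shifted path is the translated random model: this holds for the
renormalized lifts up to an error in the shift, and passes to the limit at `ω` and at `ω + h` since
the shifted measure is absolutely continuous. -/
theorem ae_model_add_eq_trans {A : ℕ → PathSpace m →L[ℝ] CameronMartin m} {ren : ℕ → 𝓜.Pt → 𝓜.Pt}
    (hA : ∀ h : CameronMartin m, Tendsto (fun n => A n (cmPath h)) atTop (𝓝 h))
    (hcomm : ∀ n h M, ren n (𝓜.trans h M) = 𝓜.trans h (ren n M))
    (hlim : ∀ᵐ ω ∂μ, Tendsto (fun n => ren n (𝓜.lift (A n ω))) atTop (𝓝 (W ω)))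
    {h : CameronMartin m} (hq : Measure.QuasiMeasurePreserving (fun ω => ω + cmPath h) μ μ) :
    ∀ᵐ ω ∂μ, W (ω + cmPath h) = 𝓜.trans h (W ω) := by
  filter_upwards [hlim, hq.ae hlim] with ω h1 h2
  refine tendsto_nhds_unique h2 ?_
  have h3 := (𝓜.continuous_trans.tendsto (h, W ω)).comp ((hA h).prodMk_nhds h1)
  refine h3.congr fun n => ?_
  rw [Function.comp_apply, ← hcomm, 𝓜.trans_lift, map_add]

end Shift

/-! ### Call prices -/

section CallPrice

variable {m : ℕ} {S : SymbolSet m} {𝓜 : ModelSpace S} {μ : Measure (PathSpace m)}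
  {W : PathSpace m → 𝓜.Pt} {e : ℝ → ℝ} {X : ℝ → PathSpace m → C(I, ℝ)}
  {Φ : ℝ → 𝓜.Pt → C(I, ℝ)} {Λ : ℝ → ℝ≥0∞}

theorem RobustAssumption.ae_eq_mul (h_robust : RobustAssumption 𝓜 μ e X Φ W) {ε : ℝ}
    (hε : ε ∈ Set.Ioc (0 : ℝ) 1) (he : 0 < e ε) :
    ∀ᵐ ω ∂μ, X ε ω 1 = ε / e ε * Φ ε (𝓜.dil (e ε) (W ω)) 1 := by
  filter_upwards [h_robust.representation ε hε] with ω hω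
  have hε0 := hε.1
  rw [← hω, ContinuousMap.smul_apply, smul_eq_mul]
  field_simp

theorem RobustAssumption.aemeasurable_apply_one (h_robust : RobustAssumption 𝓜 μ e X Φ W) {ε : ℝ}
    (hε : ε ∈ Set.Ioc (0 : ℝ) 1) (he : 0 < e ε) : AEMeasurable (fun ω => X ε ω 1) μ := by
  have h1 : AEMeasurable (fun ω => Φ ε (𝓜.dil (e ε) (W ω)) 1) μ :=
    (((continuous_apply_one h_robust.continuousOn ⟨hε.1.le, hε.2⟩).comp
      (𝓜.continuous_dil (e ε))).comp_aestronglyMeasurable h_robust.measurable).aemeasurable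
  exact (h1.const_mul (ε / e ε)).congr ((h_robust.ae_eq_mul hε he).mono fun ω hω => hω.symm)

/-- The rate function of the log-price is the minimal energy, by the contraction principle. -/
theorem rate_controlMap_le (h_ldp : LargeDeviationAssumption μ e X Λ)
    (h_robust : RobustAssumption 𝓜 μ e X Φ W) (h : CameronMartin m) :
    Λ (controlMap 𝓜 Φ h) ≤ ENNReal.ofReal (‖h‖ ^ 2 / 2) := by
  refine (rate_comp_le (f := fun ε M => Φ ε M 1) (fun ε => sq_nonneg (e ε)) h_robust.schilder
    h_ldp.ldp (continuousOn_apply_one h_robust.continuousOn) ?_ (𝓜.lift h)).trans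
    (ModelSpace.schilderRate_lift_le h)
  intro ε hε
  filter_upwards [h_robust.representation ε hε] with ω hω
  rw [← hω]
  rfl

theorem exists_control_of_rate_lt (h_ldp : LargeDeviationAssumption μ e X Λ)
    (h_robust : RobustAssumption 𝓜 μ e X Φ W) (y : ℝ) (c : ℝ≥0∞) (hy : Λ y < c) :
    ∃ h, controlMap 𝓜 Φ h = y ∧ ENNReal.ofReal (‖h‖ ^ 2 / 2) < c := by
  obtain ⟨M, hM, hMc⟩ := exists_rate_lt_of_rate_lt (f := fun ε M => Φ ε M 1)
    (fun ε => sq_nonneg (e ε)) h_robust.schilder h_ldp.ldp h_robust.good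
    (continuousOn_apply_one h_robust.continuousOn) (fun ε hε => by
      filter_upwards [h_robust.representation ε hε] with ω hω
      rw [← hω]
      rfl) hy
  obtain ⟨h, rfl, hh⟩ := ModelSpace.exists_lift_of_schilderRate_lt hMc
  exact ⟨h, hM, hh⟩

theorem eventually_callPrice_lt_top [IsFiniteMeasure μ] (h_moment : MomentAssumption μ X)
    (k : ℝ → ℝ) : ∀ᶠ ε in 𝓝[>] (0 : ℝ), callPrice μ X ε (k ε) < ∞ := by
  obtain ⟨p, hp, hlim⟩ := h_moment
  filter_upwards [eventually_lt_of_limsup_lt hlim] with ε hε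
  have hbound : callPrice μ X ε (k ε)
      ≤ ∫⁻ ω, (1 + ENNReal.ofReal (Real.exp (X ε ω 1) ^ p)) ∂μ := by
    refine lintegral_mono fun ω => ?_
    rw [← ENNReal.ofReal_one, ← ENNReal.ofReal_add zero_le_one (by positivity)]
    refine ENNReal.ofReal_le_ofReal (max_le ?_ (by positivity))
    have h0 := Real.exp_pos (X ε ω 1)
    have hk := Real.exp_pos (k ε)
    have hpow : (0 : ℝ) ≤ Real.exp (X ε ω 1) ^ p := by positivity
    rcases le_total (Real.exp (X ε ω 1)) 1 with h1 | h1
    · linarith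
    · have := Real.self_le_rpow_of_one_le h1 hp.le
      linarith
  refine hbound.trans_lt ?_
  rw [lintegral_add_left measurable_const, lintegral_one]
  exact ENNReal.add_lt_top.2 ⟨measure_lt_top μ _, hε⟩

end CallPrice

theorem theorem5p1 {m : ℕ} (S : SymbolSet m) (𝓜 : ModelSpace S)
    (μ : Measure (PathSpace m)) (hμ : IsWienerMeasure μ)
    (e : ℝ → ℝ) (X : ℝ → PathSpace m → C(I, ℝ)) (Λ : ℝ → ℝ≥0∞)
    (Φ : ℝ → 𝓜.Pt → C(I, ℝ)) (W : PathSpace m → 𝓜.Pt)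
    (G₁₀ G₂₀ G₁ G₂ : CameronMartin m → 𝓜.Pt → ℝ)
    (R₀ R : CameronMartin m → ℝ → 𝓜.Pt → ℝ)
    (x : ℝ) (hx_pos : 0 < x) (hx : CameronMartin m)
    (h_ldp : LargeDeviationAssumption μ e X Λ)
    (h_moment : MomentAssumption μ X)
    (h_robust : RobustAssumption 𝓜 μ e X Φ W)
    (h_taylor : TaylorAssumption 𝓜 Φ G₁₀ G₂₀ R₀)
    (h_taylor' : PerturbedTaylorAssumption 𝓜 e Φ G₁₀ G₂₀ G₁ G₂ R)
    (h_control : ControlAssumption (controlMap 𝓜 Φ) Λ x hx) :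
    DifferentiableAt ℝ (realRate Λ) x ∧
    (∀ ε ∈ Set.Ioc (0 : ℝ) 1,
      callPrice μ X ε (x * ε / e ε)
        = ENNReal.ofReal (Real.exp (-realRate Λ x / e ε ^ 2) * Real.exp (x * ε / e ε))
          * callFactor μ (deriv (realRate Λ) x) ε (e ε)
              (taylorCoeff G₁ W hx) (taylorCoeff G₂ W hx) (taylorRemainder R W hx ε)) ∧
    (∀ᶠ ε in 𝓝[>] (0 : ℝ),
      callPrice μ X ε (x * ε / e ε) < ∞ ∧
      callFactor μ (deriv (realRate Λ) x) ε (e ε)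
        (taylorCoeff G₁ W hx) (taylorCoeff G₂ W hx) (taylorRemainder R W hx ε) < ∞) ∧
    μ.map (taylorCoeff G₁ W hx)
      = gaussianReal 0 (Var[taylorCoeff G₁ W hx; μ]).toNNReal ∧
    deriv (realRate Λ) x ^ 2 * Var[taylorCoeff G₁ W hx; μ] = 2 * realRate Λ x ∧
    (realRate Λ x ≠ 0 → deriv (realRate Λ) x ≠ 0 ∧
      Var[taylorCoeff G₁ W hx; μ] = 2 * realRate Λ x / deriv (realRate Λ) x ^ 2) := by
  have hgauss := hμ.gaussian
  obtain ⟨A, ren, hA, hpath, hcomm, hlim⟩ := h_robust.wongZakai.exists_tendsto_ae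
  have hGeq : G₁ hx = G₁₀ hx := funext (h_taylor'.first hx)
  have hGlin : IsContinuousLinear 𝓜 (G₁ hx) := hGeq ▸ h_taylor.linear hx
  have hGcont : Continuous (G₁ hx) := by
    rw [hGeq]
    exact h_taylor.continuous_G₁.comp (by fun_prop : Continuous fun M : 𝓜.Pt => (hx, M))
  -- A surjective `fderiv` is nonzero, hence not the value taken at a point of non-differentiability.
  have hdiff : DifferentiableAt ℝ (controlMap 𝓜 Φ) hx := by
    by_contra hnd
    obtain ⟨w, hw⟩ := h_control.surjective 1
    rw [fderiv_zero_of_not_differentiableAt hnd] at hw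
    exact zero_ne_one hw
  set D := fderiv ℝ (controlMap 𝓜 Φ) hx
  -- The differential of the control map is `k ↦ G₁ (lift k)`.
  have hDG : ∀ k, D k = G₁ hx (𝓜.lift k) := fun k => by
    rw [hGeq]; exact h_taylor.fderiv_controlMap hdiff k
  have hdir : ∀ k, HasStrictDirDerivAt (controlMap 𝓜 Φ) hx k (D k) := fun k => by
    rw [hDG, hGeq]; exact h_taylor.hasStrictDirDerivAt hx k
  -- The kernel of `D` has codimension one; `v` is a direction transversal to it.
  obtain ⟨v, hv⟩ := h_control.surjective 1
  have hdv : HasStrictDirDerivAt (controlMap 𝓜 Φ) hx v 1 := hv ▸ hdir v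
  have hφ := continuous_controlMap h_robust.continuousOn
  set q : ℝ := inner ℝ hx v with hq
  have hmin : ∀ h, controlMap 𝓜 Φ h = controlMap 𝓜 Φ hx → h ≠ hx → ‖hx‖ < ‖h‖ :=
    fun h hh => h_control.unique_minimizer h (hh.trans h_control.admissible)
  have hlagrange : ∀ k, inner ℝ hx k = q * D k := by
    intro k
    have hker : D (k - D k • v) = 0 := by
      rw [map_sub, map_smul, hv, smul_eq_mul, mul_one, sub_self]
    have h1 := inner_eq_zero_of_minimizer hdv hφ
      (fun h hh => by
        by_cases hne : h = hx
        · rw [hne]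
        · exact (hmin h hh hne).le)
      (hker ▸ hdir (k - D k • v)) (by
        have h2 := hdir (-(k - D k • v))
        rwa [map_neg, hker, neg_zero] at h2)
    rw [inner_sub_right, inner_smul_right, ← hq] at h1
    linarith
  have hderiv : HasDerivAt (realRate Λ) q x := by
    refine hasDerivAt_realRate hdv hφ h_ldp.continuous_rate h_control.admissible h_control.energy
      (rate_controlMap_le h_ldp h_robust) (exists_control_of_rate_lt h_ldp h_robust) fun δ hδ => ?_
    have h1 := norm_sub_lt_of_near_minimizer (φ := controlMap 𝓜 Φ)
      (continuous_apply_one h_robust.continuousOn ⟨le_rfl, zero_le_one⟩) (fun h => rfl) hGcont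
      (fun k => by rw [hlagrange k, hDG]) (ModelSpace.lift_injective hA) h_robust.good hmin hδ
    rwa [h_control.admissible] at h1
  have hrate : realRate Λ x = ‖hx‖ ^ 2 / 2 := by
    rw [realRate, h_control.energy, ENNReal.toReal_ofReal (by positivity)]
  rw [hderiv.deriv]
  -- `g₁` is the Wiener integral of the Riesz representer `l` of the differential, and `hx = q • l`.
  set g : PathSpace m → ℝ := taylorCoeff G₁ W hx with hg
  have hglim : ∀ᵐ ω ∂μ, Tendsto (fun n => G₁ hx (𝓜.lift (A n ω))) atTop (𝓝 (g ω)) := by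
    filter_upwards [hlim] with ω hω
    refine ((hGcont.tendsto (W ω)).comp hω).congr fun n => ?_
    exact hGlin.congr_path (hpath n _)
  set l : CameronMartin m := (InnerProductSpace.toDual ℝ (CameronMartin m)).symm D
  have hlD : ∀ k, inner ℝ l k = D k := fun k => InnerProductSpace.toDual_symm_apply
  have hgl : ∀ᵐ ω ∂μ, Tendsto (fun n => inner ℝ l (A n ω)) atTop (𝓝 (g ω)) := by
    simpa only [hlD, hDG] using hglim
  have hxl : hx = q • l := ext_inner_right ℝ fun k => by
    rw [hlagrange, real_inner_smul_left, hlD]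
  have hvar : q ^ 2 * Var[g; μ] = 2 * realRate Λ x := by
    have h1 : ‖hx‖ ^ 2 = q ^ 2 * ‖l‖ ^ 2 := by
      rw [hxl, norm_smul, mul_pow, Real.norm_eq_abs, sq_abs]
    rw [hμ.variance_eq_norm_sq hA hgl, hrate, h1]
    ring
  have hgm : AEMeasurable g μ :=
    (hGcont.comp_aestronglyMeasurable h_robust.measurable).aemeasurable
  have hprice : ∀ ε ∈ Set.Ioc (0 : ℝ) 1, callPrice μ X ε (x * ε / e ε)
      = ENNReal.ofReal (Real.exp (-realRate Λ x / e ε ^ 2) * Real.exp (x * ε / e ε))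
        * callFactor μ q ε (e ε) g (taylorCoeff G₂ W hx) (taylorRemainder R W hx ε) := by
    intro ε hε
    have he : 0 < e ε := hε.1.trans_le (h_ldp.le_scale ε hε)
    -- Shift by `hx / ē`, so that the dilation by `ē` turns the shift into translation by `hx`.
    set h' : CameronMartin m := (1 / e ε) • hx with hh'
    have hehx : e ε • h' = hx := by rw [hh', smul_smul, mul_one_div_cancel he.ne', one_smul]
    have hnorm : ‖h'‖ ^ 2 = ‖hx‖ ^ 2 / e ε ^ 2 := by
      rw [hh', norm_smul, mul_pow, Real.norm_eq_abs, sq_abs]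
      ring
    have hg' : ∀ᵐ ω ∂μ, Tendsto (fun n => inner ℝ h' (A n ω)) atTop (𝓝 (q / e ε * g ω)) := by
      filter_upwards [hgl] with ω hω
      refine (hω.const_mul (q / e ε)).congr fun n => ?_
      rw [hh', hxl, smul_smul, real_inner_smul_left]
      ring
    have hmap := hμ.map_add_cmPath hA hg'
    have hqmp : Measure.QuasiMeasurePreserving (fun ω => ω + cmPath h') μ μ :=
      ⟨measurable_add_const _, by rw [hmap]; exact withDensity_absolutelyContinuous _ _⟩
    have hWshift := ae_model_add_eq_trans hA hcomm hlim hqmp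
    have hXm := h_robust.aemeasurable_apply_one hε he
    rw [callPrice, lintegral_eq_lintegral_add (by fun_prop) (by fun_prop) hmap, callFactor,
      ← lintegral_const_mul' _ _ ENNReal.ofReal_ne_top]
    refine lintegral_congr_ae ?_
    filter_upwards [hWshift, hqmp.ae (h_robust.ae_eq_mul hε he)] with ω hω hXω
    have hgω : q / e ε * g (ω + cmPath h') = q / e ε * g ω + ‖hx‖ ^ 2 / e ε ^ 2 := by
      have h1 : g (ω + cmPath h') = g ω + G₁ hx (𝓜.lift h') := by
        rw [hg, taylorCoeff, taylorCoeff, hω, hGlin.trans]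
      have h2 : q * G₁ hx (𝓜.lift h') = ‖hx‖ ^ 2 / e ε := by
        rw [← hDG, ← hlagrange, hh', real_inner_smul_right, real_inner_self_eq_norm_sq]
        ring
      rw [h1, mul_add, div_mul_eq_mul_div q (e ε) (G₁ hx (𝓜.lift h')), h2]
      ring
    have hXexp : X ε (ω + cmPath h') 1
        = x * ε / e ε + (ε * g ω + e ε * ε * taylorCoeff G₂ W hx ω
          + ε / e ε * taylorRemainder R W hx ε ω) := by
      have h1 := h_taylor'.expansion hx ε hε (W ω)
      have h2 : Φ 0 (𝓜.lift hx) 1 = x := h_control.admissible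
      rw [hXω, hω, 𝓜.dil_trans', hehx, h1, h2]
      simp only [hg, taylorCoeff, taylorRemainder]
      field_simp
      ring
    rw [hXexp, hgω, hnorm, hrate, ← ENNReal.ofReal_mul (le_max_right _ _),
      ← ENNReal.ofReal_mul (by positivity)]
    congr 1
    set k := x * ε / e ε
    set Z := ε * g ω + e ε * ε * taylorCoeff G₂ W hx ω + ε / e ε * taylorRemainder R W hx ε ω
    have hmax : max (Real.exp (k + Z) - Real.exp k) 0 = Real.exp k * max (Real.exp Z - 1) 0 := by
      rw [mul_max_of_nonneg _ _ (Real.exp_pos k).le, mul_zero, Real.exp_add, mul_sub, mul_one]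
    have hexp : Real.exp (-(q / e ε * g ω + ‖hx‖ ^ 2 / e ε ^ 2 - ‖hx‖ ^ 2 / e ε ^ 2 / 2))
        = Real.exp (-(‖hx‖ ^ 2 / 2) / e ε ^ 2) * Real.exp (-(q * g ω) / e ε) := by
      rw [← Real.exp_add]
      congr 1
      ring
    rw [hmax, hexp]
    ring
  refine ⟨hderiv.differentiableAt, hprice, ?_, hμ.map_eq_gaussianReal hgl, hvar, fun hne => ?_⟩
  · filter_upwards [eventually_callPrice_lt_top h_moment fun ε => x * ε / e ε,
      Ioc_mem_nhdsGT zero_lt_one] with ε hfin hε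
    refine ⟨hfin, ?_⟩
    rw [hprice ε hε] at hfin
    refine lt_of_le_of_ne le_top fun htop => ?_
    rw [htop, ENNReal.mul_top (ENNReal.ofReal_pos.2 (by positivity)).ne'] at hfin
    exact lt_irrefl _ hfin
  · have hq0 : q ≠ 0 := by
      rintro h0
      rw [h0] at hvar
      apply hne
      linarith
    exact ⟨hq0, by rw [← hvar]; field_simp⟩
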